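/- A parameterized problem is a language $L\subseteq\Sigma^*\times\mathbb N$ over a fixed finite alphabet $\Sigma$; the size of $(x,k)$ is $|(x,k)|=|x|+k$. An FPT reduction from $L_1$ to $L_2$ is a map $R:\Sigma^*\times\mathbb N\to\Sigma^*\times\mathbb N$ such that, for all $(x,k)$ with $(x',k')=R(x,k)$: (1) $(x,k)\in L_1$ if and only if $(x',k')\in L_2$; (2) $k'\le g(k)$ for some computable function $g$; (3) $(x',k')$ can be computed in time $f(k)\cdot|(x,k)|^{O(1)}$ for some computable function $f$. It is a polynomial-time FPT reduction if in (3) the factor $f(k)$ is replaced by a constant. Two parameterized problems are FPT-equivalent if there are FPT reductions between them in both directions. For a finite simple graph $G$ let $N(v)$ and $N[v]=N(v)\cup\{v\}$ denote the open and the closed neighborhood of a vertex $v$. A sequence $(v_1,\dots,v_k)$ of pairwise different vertices of $G$ is a dominating sequence if $N[v_i]\setminus\bigcup_{j<i}N[v_j]\neq\emptyset$ for all $i$, a total dominating sequence if $N(v_i)\setminus\bigcup_{j<i}N(v_j)\neq\emptyset$ for all $i$, and an $L$-sequence if $N[v_i]\setminus\bigcup_{j<i}N(v_j)\neq\emptyset$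 for all $i$. For a finite hypergraph $H=(X,\mathcal E)$ with $\mathcal E\subseteq\mathcal P(X)$, a sequence $(C_1,\dots,C_k)$ of edges $C_i\in\mathcal E$ is a covering sequence if $C_i\setminus\bigcup_{j<i}C_j\neq\emptyset$ for all $i$. Consider the following problems, each parameterized by $k$. All graphs that occur as instances are finite, simple and without isolated vertices; graphs are given by adjacency matrices and hypergraphs by incidence matrices. - Grundy Domination: given a graph $G$ and $k\in\mathbb N$, is there a dominating sequence of $G$ of length at least $k$? - Total Grundy Domination: given a graph $G$ and $k\in\mathbb N$, is there a total dominating sequence of $G$ of length at least $k$? - One-Sided Grundy Total Domination: given a bipartite graph $G$ with bipartition $V(G)=A\mathbin{\dot\cup}B$ and $k\in\mathbb N$, is there a total dominating sequence of $G$ of length $k$ that contains only vertices of $A$? - L-Grundy Domination: given a graph $G$ and $k\in\mathbb N$, is there an $L$-sequence of $G$ of length at least $k$? - Grundy Covering in Hypergraphs: given a hypergraph $H$ and $k\in\mathbb N$, is there a covering sequence of $H$ of length at least $k$? **Theorem.** These five problems are pairwise FPT-equivalent. Moreover, between any two of them there are polynomial-time FPT reductions in both directions. -/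

import Mathlib

noncomputable section

namespace GrundyFPT

/-! ### Parameterized problems and FPT reductions -/

/-- A parameterized problem over the alphabet `α`: a language `L ⊆ α* × ℕ`. -/
abbrev ParamProblem (α : Type) := Set (List α × ℕ)

/-- The word that is put on the input (output) stack of a machine for the pair `(x, k)`: the
parameter in unary, written with the extra symbol `none`, followed by `x`. -/
def encodePair {α : Type} (p : List α × ℕ) : List (Option α) :=
  List.replicate p.2 none ++ p.1.map some

/-- The size `|(x, k)| = |x| + k` of an instance. -/
def instanceSize {α : Type} (p : List α × ℕ) : ℕ := p.1.length + p.2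

/-- Some (multi-stack) Turing machine computes `R`, and on every input `p` it makes at most `T p`
steps. -/
def ComputableWithin {α : Type} (R : List α × ℕ → List α × ℕ) (T : List α × ℕ → ℕ) : Prop :=
  ∃ M : Turing.TM2ComputableAux (Option α) (Option α), ∀ p,
    Nonempty (Turing.TM2OutputsInTime M.tm
      ((encodePair p).map M.inputAlphabet.symm)
      (some ((encodePair (R p)).map M.outputAlphabet.symm)) (T p))

/-- `R` maps yes-instances of `L₁` to yes-instances of `L₂` and no-instances to no-instances, and
the new parameter is bounded by a computable function of the old one. -/
def IsParamReduction {α : Type} (L₁ L₂ : ParamProblem α) (R : List α × ℕ → List α × ℕ) : Prop :=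
  (∀ p, p ∈ L₁ ↔ R p ∈ L₂) ∧ ∃ g : ℕ → ℕ, Computable g ∧ ∀ p, (R p).2 ≤ g p.2

/-- There is an FPT reduction from `L₁` to `L₂`: it is computed in time
`f k * |(x, k)| ^ O(1)` for a computable function `f`. -/
def FPTReducible {α : Type} (L₁ L₂ : ParamProblem α) : Prop :=
  ∃ R, IsParamReduction L₁ L₂ R ∧
    ∃ f : ℕ → ℕ, Computable f ∧ ∃ q : Polynomial ℕ,
      ComputableWithin R fun p => f p.2 * q.eval (instanceSize p)

/-- There is a polynomial-time FPT reduction from `L₁` to `L₂`. -/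
def PolyTimeFPTReducible {α : Type} (L₁ L₂ : ParamProblem α) : Prop :=
  ∃ R, IsParamReduction L₁ L₂ R ∧
    ∃ q : Polynomial ℕ, ComputableWithin R fun p => q.eval (instanceSize p)

/-- FPT equivalence: FPT reductions in both directions. -/
def FPTEquivalent {α : Type} (L₁ L₂ : ParamProblem α) : Prop :=
  FPTReducible L₁ L₂ ∧ FPTReducible L₂ L₁

/-! ### Dominating sequences -/

/-- The closed neighborhood `N[v]`. -/
def closedNbhd {V : Type} (G : SimpleGraph V) (v : V) : Set V := insert v (G.neighborSet v)

/-- `s` is a sequence of pairwise different vertices such that, for every `i`, the set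
`N₁ (s i) \ ⋃ j < i, N₂ (s j)` is not empty. -/
def IsFootprintSeq {V : Type} (N₁ N₂ : V → Set V) {k : ℕ} (s : Fin k → V) : Prop :=
  Function.Injective s ∧ ∀ i, (N₁ (s i) \ ⋃ j, ⋃ _ : j < i, N₂ (s j)).Nonempty

def IsDominatingSeq {V : Type} (G : SimpleGraph V) {k : ℕ} (s : Fin k → V) : Prop :=
  IsFootprintSeq (closedNbhd G) (closedNbhd G) s

def IsTotalDominatingSeq {V : Type} (G : SimpleGraph V) {k : ℕ} (s : Fin k → V) : Prop :=
  IsFootprintSeq G.neighborSet G.neighborSet s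

def IsLSeq {V : Type} (G : SimpleGraph V) {k : ℕ} (s : Fin k → V) : Prop :=
  IsFootprintSeq (closedNbhd G) G.neighborSet s

/-- Covering sequences of a hypergraph. -/
def IsCoveringSeq {X : Type} (H : Hypergraph X) {k : ℕ} (C : Fin k → Set X) : Prop :=
  (∀ i, C i ∈ H.edgeSet) ∧ ∀ i, (C i \ ⋃ j, ⋃ _ : j < i, C j).Nonempty

/-! ### Instances as words -/

/-- The fixed finite alphabet over which the instances are written. -/
inductive Letter
  | zero
  | one
  | sep

open Classical in
/-- A row of a 0-1 matrix, followed by a separator. -/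
def encodeRow {n : ℕ} (r : Fin n → Prop) : List Letter :=
  List.ofFn (fun j => if r j then Letter.one else Letter.zero) ++ [Letter.sep]

/-- The adjacency matrix of `G`, row by row. -/
def encodeGraph {n : ℕ} (G : SimpleGraph (Fin n)) : List Letter :=
  (List.ofFn fun i => encodeRow (G.Adj i)).flatten

/-- A graph with a distinguished vertex set `A`: the indicator vector of `A`, then the adjacency
matrix. -/
def encodeGraphWithSet {n : ℕ} (G : SimpleGraph (Fin n)) (A : Set (Fin n)) : List Letter :=
  encodeRow (fun v => v ∈ A) ++ encodeGraph G

/-- A hypergraph with vertices `0, …, n - 1` whose edges are listed in `l`: a row of `n` ones, then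
for each listed edge its indicator vector. -/
def encodeHypergraph (n : ℕ) (l : List (Set (Fin n))) : List Letter :=
  encodeRow (fun _ : Fin n => True) ++ l.flatMap fun e => encodeRow (fun v => v ∈ e)

/-! ### The five problems -/

/-- All graphs considered as instances have no isolated vertices. -/
def NoIsolated {V : Type} (G : SimpleGraph V) : Prop := ∀ v, ¬ G.IsIsolated v

/-- Grundy Domination. -/
def GrundyDomination : ParamProblem Letter :=
  {p | ∃ (n : ℕ) (G : SimpleGraph (Fin n)), p.1 = encodeGraph G ∧ NoIsolated G ∧
    ∃ m ≥ p.2, ∃ s : Fin m → Fin n, IsDominatingSeq G s}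

/-- Total Grundy Domination. -/
def TotalGrundyDomination : ParamProblem Letter :=
  {p | ∃ (n : ℕ) (G : SimpleGraph (Fin n)), p.1 = encodeGraph G ∧ NoIsolated G ∧
    ∃ m ≥ p.2, ∃ s : Fin m → Fin n, IsTotalDominatingSeq G s}

/-- L-Grundy Domination. -/
def LGrundyDomination : ParamProblem Letter :=
  {p | ∃ (n : ℕ) (G : SimpleGraph (Fin n)), p.1 = encodeGraph G ∧ NoIsolated G ∧
    ∃ m ≥ p.2, ∃ s : Fin m → Fin n, IsLSeq G s}

/-- One-Sided Grundy Total Domination: the input is a bipartite graph with bipartition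
`(A, Aᶜ)`. -/
def OneSidedGrundyTotalDomination : ParamProblem Letter :=
  {p | ∃ (n : ℕ) (G : SimpleGraph (Fin n)) (A : Set (Fin n)), p.1 = encodeGraphWithSet G A ∧
    G.IsBipartiteWith A Aᶜ ∧ NoIsolated G ∧
    ∃ s : Fin p.2 → Fin n, IsTotalDominatingSeq G s ∧ ∀ i, s i ∈ A}

/-- Grundy Covering in Hypergraphs. The edge set is the set of the listed edges. -/
def GrundyCovering : ParamProblem Letter :=
  {p | ∃ (n : ℕ) (H : Hypergraph (Fin n)) (l : List (Set (Fin n))),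
    H.vertexSet = Set.univ ∧ H.edgeSet = {e | e ∈ l} ∧ p.1 = encodeHypergraph n l ∧
    ∃ m ≥ p.2, ∃ C : Fin m → Set (Fin n), IsCoveringSeq H C}

end GrundyFPT

end

noncomputable section

namespace GrundyFPT

open Function

/-! All five problems ask the same question. For a relation `J` between rows and columns, a
triangular sequence of length `k` consists of rows `a i` and columns `b i` with `J (a i) (b i)` and
`¬ J (a j) (b i)` for `j < i` (`HasTri`). Dominating, total dominating and covering sequences are
triangular sequences for closed adjacency, adjacency and incidence of edges with points. The
one-sided problem only restricts the rows to `A`, and L-sequences become triangular when the columns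
are two copies of the vertex set (`exists_isLSeq_iff`).

Conversely, each problem can express the question for an arbitrary `J` with `M` rows and `N`
columns. The matrix of `J` is itself a hypergraph. For the graph problems, rows and columns become
two cliques, `J` gives the edges between them, and each clique receives two further vertices without
neighbors on the other side (`cobGraph`). A chosen vertex takes care of its whole clique, up to
itself when neighborhoods are open. Hence, apart from the positions at the two ends, a sequence
chooses only rows and footprints only columns, or the reverse; the reverse case is the transposed
relation, and reading a triangular sequence backwards transposes it. The ends account for two
positions with closed neighborhoods and for four in the total and L versions. So `k` corresponds to
`k + 2` or `k + 4` (`IsCobip.exists_isDominatingSeq_iff`, `IsCobip.exists_isTotalDominatingSeq_iff`,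
`IsCobip.exists_isLSeq_iff`). The one-sided problem on the bipartite double cover is the total
problem on the graph.

Thus every problem reduces to every other by rewriting a 0-1 matrix and adding a constant to the
parameter. For the time bound the rewriting is expressed in a small language of arithmetic with
bounded sums and loops over the input word (`Expr`, `Out`). Its expressions compile to structured
stack programs (`Prog`), and these to multi-stack Turing machines. `Out.computableWithin` gives
polynomial time for every expression of the language at once. -/

/-! ### Structured stack programs -/

/-- Structured programs over stacks indexed by `K` with symbols in `A`. -/
inductive Prog (K A : Type) : Type
  | skip : Prog K A
  | push (k : K) (a : A) : Prog K A
  | pop (k : K) : Prog K A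
  | move (k k' : K) : Prog K A
  | seq (p q : Prog K A) : Prog K A
  | ite (k : K) (c : Option A → Bool) (p q : Prog K A) : Prog K A
  | loop (k : K) (c : Option A → Bool) (p : Prog K A) : Prog K A

namespace Prog

variable {K A : Type}

/-- `Exec p s t s'`: started with the stacks `s`, the program `p` ends after `t` steps with the
stacks `s'`. -/
inductive Exec [DecidableEq K] : Prog K A → (K → List A) → ℕ → (K → List A) → Prop
  | skip {s} : Exec skip s 1 s
  | push {s k a} : Exec (push k a) s 1 (update s k (a :: s k))
  | pop {s k} : Exec (pop k) s 1 (update s k (s k).tail)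
  | move_nil {s k k'} : s k = [] → Exec (move k k') s 1 s
  | move_cons {s k k' a l} : s k = a :: l →
      Exec (move k k') s 1 (update (update s k l) k' (a :: update s k l k'))
  | seq {p q s t s' t' s''} : Exec p s t s' → Exec q s' t' s'' → Exec (seq p q) s (t + t') s''
  | ite_true {k c p q s t s'} : c (s k).head? = true → Exec p s t s' →
      Exec (ite k c p q) s (t + 1) s'
  | ite_false {k c p q s t s'} : c (s k).head? = false → Exec q s t s' →
      Exec (ite k c p q) s (t + 1) s'
  | loop_done {k c p s} : c (s k).head? = false → Exec (loop k c p) s 1 s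
  | loop_step {k c p s t s' t' s''} : c (s k).head? = true → Exec p s t s' →
      Exec (loop k c p) s' t' s'' → Exec (loop k c p) s (t + t' + 1) s''

/-- The stacks that a program mentions. -/
def usedStacks [DecidableEq K] : Prog K A → Finset K
  | skip => ∅
  | push k _ => {k}
  | pop k => {k}
  | move k k' => {k, k'}
  | seq p q => p.usedStacks ∪ q.usedStacks
  | ite k _ p q => insert k (p.usedStacks ∪ q.usedStacks)
  | loop k _ p => insert k p.usedStacks

/-- The labels of the machine for a program. -/
def Lab : Prog K A → Type
  | skip => Unit
  | push _ _ => Unit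
  | pop _ => Unit
  | move _ _ => Unit
  | seq p q => p.Lab ⊕ q.Lab
  | ite _ _ p q => Option (p.Lab ⊕ q.Lab)
  | loop _ _ p => Option p.Lab

/-- The label at which a program is entered. -/
def start : (p : Prog K A) → p.Lab
  | skip => ()
  | push _ _ => ()
  | pop _ => ()
  | move _ _ => ()
  | seq p _ => Sum.inl p.start
  | ite _ _ _ _ => none
  | loop _ _ _ => none

instance finiteLab : (p : Prog K A) → Finite p.Lab
  | skip => inferInstanceAs (Finite Unit)
  | push _ _ => inferInstanceAs (Finite Unit)
  | pop _ => inferInstanceAs (Finite Unit)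
  | move _ _ => inferInstanceAs (Finite Unit)
  | seq p q =>
    have := finiteLab p
    have := finiteLab q
    inferInstanceAs (Finite (p.Lab ⊕ q.Lab))
  | ite _ _ p q =>
    have := finiteLab p
    have := finiteLab q
    inferInstanceAs (Finite (Option (p.Lab ⊕ q.Lab)))
  | loop _ _ p =>
    have := finiteLab p
    inferInstanceAs (Finite (Option p.Lab))

/-! ### Translation of programs to multi-stack Turing machines. -/

variable {K' L : Type}

/-- The statements of the machine for a program; `emb` places the labels of the program among the
labels of the machine, and `exit` is the label to go to at the end. -/
def code [Inhabited A] (φ : K → K') : (p : Prog K A) → (p.Lab → L) → L → p.Lab →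
    Turing.TM2.Stmt (fun _ : K' => A) L (Option A)
  | skip, _, exit, _ => .goto fun _ => exit
  | push k a, _, exit, _ => .push (φ k) (fun _ => a) (.goto fun _ => exit)
  | pop k, _, exit, _ => .pop (φ k) (fun _ _ => none) (.goto fun _ => exit)
  | move k k', _, exit, _ => .pop (φ k) (fun _ x => x) (.branch Option.isSome
      -- The default is never pushed, since this branch is taken only if the register holds a
      -- symbol. Each block leaves the register at `none` for the next one.
      (.push (φ k') (fun v => v.getD default) (.load (fun _ => none) (.goto fun _ => exit)))
      (.goto fun _ => exit))
  | seq p q, emb, exit, l => Sum.casesOn (motive := fun _ => _) l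
      (fun l => code φ p (fun l => emb (Sum.inl l)) (emb (Sum.inr q.start)) l)
      (fun l => code φ q (fun l => emb (Sum.inr l)) exit l)
  | ite k c p q, emb, exit, l => Option.casesOn (motive := fun _ => _) l
      (.peek (φ k) (fun _ x => x) (.branch c
        (.load (fun _ => none) (.goto fun _ => emb (some (Sum.inl p.start))))
        (.load (fun _ => none) (.goto fun _ => emb (some (Sum.inr q.start))))))
      (fun l => Sum.casesOn (motive := fun _ => _) l
        (fun l => code φ p (fun l => emb (some (Sum.inl l))) exit l)
        (fun l => code φ q (fun l => emb (some (Sum.inr l))) exit l))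
  | loop k c p, emb, exit, l => Option.casesOn (motive := fun _ => _) l
      (.peek (φ k) (fun _ x => x) (.branch c
        (.load (fun _ => none) (.goto fun _ => emb (some p.start)))
        (.load (fun _ => none) (.goto fun _ => exit))))
      (fun l => code φ p (fun l => emb (some l)) (emb none) l)

theorem update_comp_of_leftInv [DecidableEq K] [DecidableEq K'] {φ : K → K'} {ψ : K' → K}
    (hψ : Injective ψ) (s : K → List A) {k : K} (hk : ψ (φ k) = k) (l : List A) :
    update s k l ∘ ψ = update (s ∘ ψ) (φ k) l := by
  funext x
  by_cases h : x = φ k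
  · subst h; simp [hk]
  · have : ψ x ≠ k := fun e => h (hψ (e.trans hk.symm))
    simp [h, this]

/-- The machine started at a program does what the program does. -/
theorem Exec.iterate_step [DecidableEq K] [DecidableEq K'] [Inhabited A] {φ : K → K'}
    {ψ : K' → K} (hψ : Injective ψ) (M : L → Turing.TM2.Stmt (fun _ : K' => A) L (Option A))
    {p : Prog K A} {s : K → List A} {t : ℕ} {s' : K → List A} (h : Exec p s t s') :
    ∀ (emb : p.Lab → L) (exit : L), (∀ l, M (emb l) = p.code φ emb exit l) →
      (∀ k ∈ p.usedStacks, ψ (φ k) = k) →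
      (flip bind (Turing.TM2.step M))^[t] (some ⟨some (emb p.start), none, s ∘ ψ⟩) =
        some ⟨some exit, none, s' ∘ ψ⟩ := by
  induction h with
  | skip =>
    intro emb exit hM _
    simp [flip, hM, code]
  | @push s k a =>
    intro emb exit hM hk
    have hk := hk k (by simp [usedStacks])
    simp [flip, hM, code, update_comp_of_leftInv hψ s hk, hk]
  | @pop s k =>
    intro emb exit hM hk
    have hk := hk k (by simp [usedStacks])
    simp [flip, hM, code, update_comp_of_leftInv hψ s hk, hk]
  | @move_nil s k k' hs =>
    intro emb exit hM hk
    have hk := hk k (by simp [usedStacks])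
    simp [flip, hM, code, hk, hs]
  | @move_cons s k k' a l hs =>
    intro emb exit hM hk
    have hk' := hk k' (by simp [usedStacks])
    have hk := hk k (by simp [usedStacks])
    have h1 := update_comp_of_leftInv hψ s hk l
    have h2 : update (s ∘ ψ) (φ k) l (φ k') = update s k l k' := by
      rw [← h1, comp_apply, hk']
    simp [flip, hM, code, update_comp_of_leftInv hψ _ hk', h1, hk, hs, h2]
  | @seq p q s t s' t' s'' _ _ ihp ihq =>
    intro emb exit hM hk
    rw [Nat.add_comm, iterate_add_apply]
    have h1 := ihp (fun l => emb (Sum.inl l)) (emb (Sum.inr q.start)) (fun l => hM _)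
      (fun k h => hk k (by simp [usedStacks, h]))
    have h2 := ihq (fun l => emb (Sum.inr l)) exit (fun l => hM _)
      (fun k h => hk k (by simp [usedStacks, h]))
    rw [← h2, ← h1]; rfl
  | @ite_true k c p q s t s' hc _ ih =>
    intro emb exit hM hk
    have h1 := ih (fun l => emb (some (Sum.inl l))) exit (fun l => hM _)
      (fun k h => hk k (by simp [usedStacks, h]))
    have hk := hk k (by simp [usedStacks])
    have h0 : M (emb (ite k c p q).start) = _ := hM (ite k c p q).start
    rw [iterate_succ_apply, ← h1]
    simp only [start, code] at h0 ⊢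
    simp [flip, h0, hk, hc]
  | @ite_false k c p q s t s' hc _ ih =>
    intro emb exit hM hk
    have h1 := ih (fun l => emb (some (Sum.inr l))) exit (fun l => hM _)
      (fun k h => hk k (by simp [usedStacks, h]))
    have hk := hk k (by simp [usedStacks])
    have h0 : M (emb (ite k c p q).start) = _ := hM (ite k c p q).start
    rw [iterate_succ_apply, ← h1]
    simp only [start, code] at h0 ⊢
    simp [flip, h0, hk, hc]
  | @loop_done k c p s hc =>
    intro emb exit hM hk
    have hk := hk k (by simp [usedStacks])
    have h0 : M (emb (loop k c p).start) = _ := hM (loop k c p).start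
    simp only [start, code] at h0 ⊢
    simp [flip, h0, hk, hc]
  | @loop_step k c p s t s' t' s'' hc _ _ ihp ihl =>
    intro emb exit hM hk
    have h1 := ihp (fun l => emb (some l)) (emb none) (fun l => hM _)
      (fun k h => hk k (by simp [usedStacks, h]))
    have h2 := ihl emb exit hM hk
    have hk := hk k (by simp [usedStacks])
    rw [iterate_succ_apply, Nat.add_comm, iterate_add_apply, ← h2]
    have h0 : M (emb (loop k c p).start) = _ := hM (loop k c p).start
    simp only [start, code] at h0 ⊢
    rw [← h1]
    congr 2
    simp [flip, h0, hk, hc]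

/-- The machine that runs a program on an input stack, and whose result is on an output stack. -/
def machine [DecidableEq K] [Inhabited A] [Fintype A] (p : Prog K A) (i o : K) :
    Turing.TM2ComputableAux A A where
  tm :=
    { K := {k // k ∈ insert i (insert o p.usedStacks)}
      k₀ := ⟨i, by simp⟩
      k₁ := ⟨o, by simp⟩
      Γ := fun _ => A
      Λ := Option p.Lab
      main := some p.start
      ΛFin := Fintype.ofFinite _
      σ := Option A
      initialState := none
      Γk₀Fin := inferInstance
      m := fun l => Option.casesOn (motive := fun _ => _) l .halt (p.code
        -- A machine has finitely many stacks, whereas `K` may be infinite. The image of a stack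
        -- outside the list is irrelevant, as the program never mentions it.
        (fun k => if h : k ∈ insert i (insert o p.usedStacks) then ⟨k, h⟩ else ⟨i, by simp⟩)
        some none) }
  inputAlphabet := Equiv.refl A
  outputAlphabet := Equiv.refl A

theorem Exec.machine_outputs [DecidableEq K] [Inhabited A] [Fintype A] {p : Prog K A} {i o : K}
    {x y : List A} {t T : ℕ} (h : Exec p (update (fun _ => []) i x) t (update (fun _ => []) o y))
    (hT : t + 1 ≤ T) :
    Nonempty (Turing.TM2OutputsInTime (p.machine i o).tm
      (x.map (p.machine i o).inputAlphabet.symm)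
      (some (y.map (p.machine i o).outputAlphabet.symm)) T) := by
  -- The additional step executes `halt` at the exit label `none`.
  refine ⟨⟨⟨t + 1, ?_⟩, hT⟩⟩
  have := h.iterate_step (φ := fun k => if h : k ∈ insert i (insert o p.usedStacks) then
      (⟨k, h⟩ : {k // k ∈ insert i (insert o p.usedStacks)}) else ⟨i, by simp⟩)
    (ψ := Subtype.val) Subtype.val_injective (p.machine i o).tm.m some none (fun l => rfl)
    (fun k hk => by simp [hk])
  rw [iterate_succ_apply']
  have hi : Turing.initList (p.machine i o).tm (x.map (p.machine i o).inputAlphabet.symm) =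
      ⟨some (some p.start), none, update (fun _ => []) i x ∘ Subtype.val⟩ := by
    simp only [Turing.initList]
    congr 1
    funext k
    by_cases hk : k = (p.machine i o).tm.k₀
    · subst hk
      simp only [dite_true]
      exact List.map_id _ |>.trans (update_self i x fun _ : K => ([] : List A)).symm
    · have : k.1 ≠ i := fun e => hk (Subtype.ext e)
      simp only [hk, dite_false]
      exact (update_of_ne this x fun _ : K => ([] : List A)).symm
  have ho : Turing.haltList (p.machine i o).tm (y.map (p.machine i o).outputAlphabet.symm) =
      ⟨none, none, update (fun _ => []) o y ∘ Subtype.val⟩ := by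
    simp only [Turing.haltList]
    congr 1
    funext k
    by_cases hk : k = (p.machine i o).tm.k₁
    · subst hk
      simp only [dite_true]
      exact List.map_id _ |>.trans (update_self o y fun _ : K => ([] : List A)).symm
    · have : k.1 ≠ o := fun e => hk (Subtype.ext e)
      simp only [hk, dite_false]
      exact (update_of_ne this y fun _ : K => ([] : List A)).symm
  erw [hi, this]
  simp only [Option.map_some, ho]
  rfl

end Prog

/-! ### Execution of programs within a time bound. -/

namespace Prog

variable {K A : Type} [DecidableEq K]

/-- `Runs p s T s'`: started with the stacks `s`, the program `p` ends within `T` steps with the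
stacks `s'`. -/
def Runs (p : Prog K A) (s : K → List A) (T : ℕ) (s' : K → List A) : Prop :=
  ∃ t ≤ T, Exec p s t s'

theorem Runs.mono {p : Prog K A} {s s' : K → List A} {T T' : ℕ} (h : Runs p s T s')
    (hT : T ≤ T') : Runs p s T' s' :=
  let ⟨t, ht, h⟩ := h
  ⟨t, ht.trans hT, h⟩

theorem Runs.of_eq {p : Prog K A} {s s' r r' : K → List A} {T T' : ℕ} (h : Runs p s T s')
    (hs : s = r) (hs' : s' = r') (hT : T ≤ T') : Runs p r T' r' :=
  hs ▸ hs' ▸ h.mono hT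

theorem Runs.seq {p q : Prog K A} {s s' s'' : K → List A} {T T' : ℕ} (h : Runs p s T s')
    (h' : Runs q s' T' s'') : Runs (seq p q) s (T + T') s'' :=
  let ⟨_, ht, h⟩ := h
  let ⟨_, ht', h'⟩ := h'
  ⟨_, Nat.add_le_add ht ht', .seq h h'⟩

theorem Runs.skip {s : K → List A} : Runs Prog.skip s 1 s := ⟨1, le_rfl, .skip⟩

theorem Runs.push {s s' : K → List A} {k : K} {a : A} (h : update s k (a :: s k) = s') :
    Runs (Prog.push k a) s 1 s' :=
  ⟨1, le_rfl, h ▸ .push⟩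

theorem Runs.pop {s s' : K → List A} {k : K} (h : update s k (s k).tail = s') :
    Runs (Prog.pop k) s 1 s' :=
  ⟨1, le_rfl, h ▸ .pop⟩

theorem Runs.move_nil {s : K → List A} {k k' : K} (h : s k = []) :
    Runs (Prog.move k k') s 1 s :=
  ⟨1, le_rfl, .move_nil h⟩

theorem Runs.move_cons {s s' : K → List A} {k k' : K} {a : A} {l : List A} (h : s k = a :: l)
    (h' : update (update s k l) k' (a :: update s k l k') = s') :
    Runs (Prog.move k k') s 1 s' :=
  ⟨1, le_rfl, h' ▸ .move_cons h⟩

theorem Runs.ite_true {k : K} {c : Option A → Bool} {p q : Prog K A} {s s' : K → List A} {T : ℕ}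
    (hc : c (s k).head? = true) (h : Runs p s T s') : Runs (ite k c p q) s (T + 1) s' :=
  let ⟨_, ht, h⟩ := h
  ⟨_, Nat.add_le_add_right ht 1, .ite_true hc h⟩

theorem Runs.ite_false {k : K} {c : Option A → Bool} {p q : Prog K A} {s s' : K → List A} {T : ℕ}
    (hc : c (s k).head? = false) (h : Runs q s T s') : Runs (ite k c p q) s (T + 1) s' :=
  let ⟨_, ht, h⟩ := h
  ⟨_, Nat.add_le_add_right ht 1, .ite_false hc h⟩

/-- A loop that runs through the stacks `S n, S (n - 1), …, S 0`. -/
theorem Runs.loop {k : K} {c : Option A → Bool} {p : Prog K A} (S : ℕ → K → List A) {n N T : ℕ}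
    (hN : n ≤ N) (h0 : c (S 0 k).head? = false) (h1 : ∀ i < n, c (S (i + 1) k).head? = true)
    (h : ∀ i < n, Runs p (S (i + 1)) T (S i)) :
    Runs (loop k c p) (S n) (N * (T + 1) + 1) (S 0) := by
  suffices Runs (Prog.loop k c p) (S n) (n * (T + 1) + 1) (S 0) from
    this.mono (by gcongr)
  clear hN
  induction n with
  | zero => exact ⟨1, by simp, .loop_done h0⟩
  | succ n ih =>
    obtain ⟨t, ht, ht'⟩ := h n n.lt_succ_self
    obtain ⟨u, hu, hu'⟩ := ih (fun i hi => h1 i (by omega)) (fun i hi => h i (by omega))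
    exact ⟨_, by rw [Nat.succ_mul]; omega, .loop_step (h1 n n.lt_succ_self) ht' hu'⟩

/-- Move the whole stack `k` to the stack `k'`. -/
def moveAll (k k' : K) : Prog K A := loop k Option.isSome (move k k')

/-- The order of the symbols is reversed. This does not matter for unary numbers, and moving a word
back restores it. -/
theorem runs_moveAll {s s' : K → List A} {k k' : K} {N : ℕ} (hk : k ≠ k')
    (hN : (s k).length ≤ N)
    (h : update (update s k []) k' ((s k).reverse ++ s k') = s') :
    Runs (moveAll k k') s (N * 2 + 1) s' := by
  subst h
  have := Runs.loop (k := k) (c := Option.isSome) (p := Prog.move k k') (T := 1) (N := N)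
    (n := (s k).length) (fun i => update (update s k ((s k).drop ((s k).length - i))) k'
      (((s k).take ((s k).length - i)).reverse ++ s k')) hN (by simp [hk])
    (fun i hi => by
      simp only [update_of_ne hk, update_self, List.head?_drop]
      rw [List.getElem?_eq_getElem (by omega)]; rfl)
    (fun i hi => by
      have hlt : (s k).length - (i + 1) < (s k).length := by omega
      have h1 : (s k).length - (i + 1) + 1 = (s k).length - i := by omega
      refine Runs.move_cons (a := (s k)[(s k).length - (i + 1)])
        (l := (s k).drop ((s k).length - i)) ?_ ?_
      · simp only [update_of_ne hk, update_self]
        rw [List.drop_eq_getElem_cons hlt, h1]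
      · funext x
        by_cases hx : x = k'
        · subst hx
          simp only [update_self, update_of_ne hk.symm]
          rw [← h1, List.take_succ_eq_append_getElem hlt, List.reverse_append]
          rfl
        · by_cases hx' : x = k
          · subst hx'; simp [hx]
          · simp [hx, hx'])
  simpa [moveAll, update_eq_self] using this

end Prog

instance : DecidableEq Letter := Classical.decEq _

instance : Fintype Letter where
  elems := ⟨([.zero, .one, .sep] : List Letter), by simp⟩
  complete x := by cases x <;> simp

/-! ### Numerical expressions and word expressions -/

/-- Numerical expressions with named variables, that can read letters of a word. -/
inductive Expr : Type
  | const (c : ℕ)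
  | var (x : ℕ)
  | len
  | add (e e' : Expr)
  | mul (e e' : Expr)
  | sub (e e' : Expr)
  | read (a : Letter) (e : Expr)
  | sum (x : ℕ) (e b : Expr)

open Classical in
/-- The value of an expression for a word and an assignment of the variables. -/
def Expr.eval (w : List Letter) : Expr → (ℕ → ℕ) → ℕ
  | const c, _ => c
  | var x, env => env x
  | len, _ => w.length
  | add e e', env => e.eval w env + e'.eval w env
  | mul e e', env => e.eval w env * e'.eval w env
  | sub e e', env => e.eval w env - e'.eval w env
  | read a e, env => if w[e.eval w env]? = some a then 1 else 0
  | sum x e b, env => ∑ i ∈ Finset.range (e.eval w env), b.eval w (update env x i)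

/-- Expressions for words. -/
inductive Out : Type
  | nil
  | emit (a : Letter)
  | append (o o' : Out)
  | ite (e : Expr) (o o' : Out)
  | iter (x : ℕ) (e : Expr) (o : Out)

/-- The value of a word expression. -/
def Out.eval (w : List Letter) : Out → (ℕ → ℕ) → List Letter
  | nil, _ => []
  | emit a, _ => [a]
  | append o o', env => o.eval w env ++ o'.eval w env
  | ite e o o', env => if e.eval w env ≠ 0 then o.eval w env else o'.eval w env
  | .iter x e o, env => (List.range (e.eval w env)).flatMap fun i => o.eval w (update env x i)

/-- The stacks of the machine that evaluates expressions: the input, the output, the parameter, the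
values of the variables, and auxiliary stacks. -/
inductive Stk : Type
  | inp
  | out
  | par
  | loc (x : ℕ)
  | tmp (j : ℕ)
  deriving DecidableEq

/-- A number in unary. -/
abbrev unary (n : ℕ) : List (Option Letter) := List.replicate n none

theorem unary_append (m n : ℕ) (l : List (Option Letter)) :
    unary m ++ (unary n ++ l) = unary (m + n) ++ l := by
  rw [← List.append_assoc, List.replicate_append_replicate]

/-- The stacks given by their contents. -/
def store (w o p : List (Option Letter)) (env : ℕ → ℕ) (T : ℕ → List (Option Letter)) :
    Stk → List (Option Letter)
  | .inp => w
  | .out => o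
  | .par => p
  | .loc x => unary (env x)
  | .tmp j => T j

section store

variable (w o p l : List (Option Letter)) (env : ℕ → ℕ) (T : ℕ → List (Option Letter)) (n x j : ℕ)

@[simp] theorem store_inp : store w o p env T .inp = w := rfl
@[simp] theorem store_out : store w o p env T .out = o := rfl
@[simp] theorem store_par : store w o p env T .par = p := rfl
@[simp] theorem store_loc : store w o p env T (.loc x) = unary (env x) := rfl
@[simp] theorem store_tmp : store w o p env T (.tmp j) = T j := rfl

@[simp] theorem update_store_inp :
    update (store w o p env T) .inp l = store l o p env T := by
  funext k; cases k <;> simp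

@[simp] theorem update_store_out :
    update (store w o p env T) .out l = store w l p env T := by
  funext k; cases k <;> simp

@[simp] theorem update_store_par :
    update (store w o p env T) .par l = store w o l env T := by
  funext k; cases k <;> simp

@[simp] theorem update_store_tmp :
    update (store w o p env T) (.tmp j) l = store w o p env (update T j l) := by
  funext k; cases k <;> simp [update_apply]

@[simp] theorem update_store_loc :
    update (store w o p env T) (.loc x) (unary n) = store w o p (update env x n) T := by
  funext k; cases k <;> simp [update_apply]
  split_ifs <;> rfl

@[simp] theorem update_store_loc_nil :
    update (store w o p env T) (.loc x) [] = store w o p (update env x 0) T :=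
  update_store_loc w o p env T 0 x

end store

/-! ### Compilation of expressions to programs, with polynomial running time. -/

open Prog

/-- Push `n` times. -/
def pushMany (k : Stk) : ℕ → Prog Stk (Option Letter)
  | 0 => .skip
  | n + 1 => .seq (pushMany k n) (.push k none)

/-- The program for an expression: it puts its value on the auxiliary stack `t`; the auxiliary
stacks from `f` on are free. -/
def Expr.comp : Expr → ℕ → ℕ → Prog Stk (Option Letter)
  | const c, t, _ => pushMany (.tmp t) c
  | var x, t, f => .seq (moveAll (.loc x) (.tmp f))
      (.loop (.tmp f) Option.isSome
        (.seq (.pop (.tmp f)) (.seq (.push (.loc x) none) (.push (.tmp t) none))))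
  | len, t, f => .seq
      (.loop .inp Option.isSome (.seq (.move .inp (.tmp f)) (.push (.tmp t) none)))
      (moveAll (.tmp f) .inp)
  | add e e', t, f => .seq (e.comp t f) (e'.comp t f)
  | mul e e', t, f => .seq (e.comp f (f + 1))
      (.loop (.tmp f) Option.isSome (.seq (.pop (.tmp f)) (e'.comp t (f + 1))))
  | sub e e', t, f => .seq (.seq (e.comp f (f + 1)) (e'.comp (f + 1) (f + 2)))
      (.seq (.loop (.tmp (f + 1)) Option.isSome (.seq (.pop (.tmp (f + 1))) (.pop (.tmp f))))
        (moveAll (.tmp f) (.tmp t)))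
  | read a e, t, f => .seq (e.comp f (f + 1))
      (.seq (.loop (.tmp f) Option.isSome (.seq (.pop (.tmp f)) (.move .inp (.tmp (f + 1)))))
        (.seq (.ite .inp (fun b => decide (b = some (some a))) (.push (.tmp t) none) .skip)
          (moveAll (.tmp (f + 1)) .inp)))
  | sum x e b, t, f => .seq (.seq (e.comp f (f + 1))
        (.seq (moveAll (.loc x) (.tmp (f + 1))) (moveAll (.tmp f) (.loc x))))
      (.seq (.loop (.loc x) Option.isSome (.seq (.pop (.loc x)) (b.comp t (f + 2))))
        (moveAll (.tmp (f + 1)) (.loc x)))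

/-- Run `body` for all values of `x` below `e`, in descending order. -/
def Expr.forDown (x : ℕ) (e : Expr) (f : ℕ) (body : Prog Stk (Option Letter)) :
    Prog Stk (Option Letter) :=
  .seq (.seq (e.comp f (f + 1))
      (.seq (moveAll (.loc x) (.tmp (f + 1))) (moveAll (.tmp f) (.loc x))))
    (.seq (.loop (.loc x) Option.isSome (.seq (.pop (.loc x)) body))
      (moveAll (.tmp (f + 1)) (.loc x)))

/-- The program for a word expression: it puts its value on the output stack. -/
def Out.comp : Out → ℕ → Prog Stk (Option Letter)
  | nil, _ => .skip
  | emit a, _ => .push .out (some a)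
  | append o o', f => .seq (o'.comp f) (o.comp f)
  | ite e o o', f => .seq (e.comp f (f + 1)) (.ite (.tmp f) Option.isSome
      (.seq (.loop (.tmp f) Option.isSome (.pop (.tmp f))) (o.comp f)) (o'.comp f))
  | .iter x e o, f => e.forDown x f (o.comp (f + 2))

/-- The stack of the variable `x` serves as the loop counter: its old value is parked on `tmp (f +
1)`, the bound is moved in, and popping before each round leaves the current index for the body.
Both the output `O` and the auxiliary stacks `T` may depend on the counter, so the lemma covers
sums, which change `T`, and output loops, which change `O`. Indices descend because output is pushed
from its last letter to its first. -/
theorem runs_forDown {x : ℕ} {e : Expr} {f : ℕ} {body : Prog Stk (Option Letter)}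
    {w p : List (Option Letter)} {env : ℕ → ℕ} {O : ℕ → List (Option Letter)}
    {T : ℕ → ℕ → List (Option Letter)} {n N S te B : ℕ} (hn : n ≤ N) (hS : env x ≤ S)
    (hT : ∀ i ≤ n, ∀ j ≥ f, T i j = [])
    (he : Runs (e.comp f (f + 1)) (store w (O n) p env (T n)) te
      (store w (O n) p env (update (T n) f (unary n))))
    (hb : ∀ i < n, Runs body
      (store w (O (i + 1)) p (update env x i) (update (T (i + 1)) (f + 1) (unary (env x)))) B
      (store w (O i) p (update env x i) (update (T i) (f + 1) (unary (env x))))) :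
    Runs (e.forDown x f body) (store w (O n) p env (T n))
      (te + S * 4 + N * (B + 4) + 4) (store w (O 0) p env (T 0)) := by
  have h1 : Runs (moveAll (.loc x) (.tmp (f + 1)))
      (store w (O n) p env (update (T n) f (unary n))) (S * 2 + 1)
      (store w (O n) p (update env x 0)
        (update (update (T n) f (unary n)) (f + 1) (unary (env x)))) :=
    runs_moveAll (by simp) (by simpa using hS) (by simp [hT n le_rfl])
  have h2 : Runs (moveAll (.tmp f) (.loc x))
      (store w (O n) p (update env x 0)
        (update (update (T n) f (unary n)) (f + 1) (unary (env x)))) (N * 2 + 1)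
      (store w (O n) p (update env x n) (update (T n) (f + 1) (unary (env x)))) := by
    refine runs_moveAll (by simp) (by simpa using hn) ?_
    have : update (update (update (T n) f (unary n)) (f + 1) (unary (env x))) f [] =
        update (T n) (f + 1) (unary (env x)) := by
      rw [update_comm (by omega), update_idem, ← hT n le_rfl f le_rfl, update_eq_self]
    simp [this]
  have h3 := Runs.loop (k := Stk.loc x) (c := Option.isSome)
    (p := .seq (.pop (.loc x)) body) (T := 1 + B)
    (fun i => store w (O i) p (update env x i) (update (T i) (f + 1) (unary (env x)))) hn
    (by simp) (by simp [List.replicate_succ])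
    (fun i hi => Runs.seq (.pop (by simp)) (hb i hi))
  have h4 : Runs (moveAll (.tmp (f + 1)) (.loc x))
      (store w (O 0) p (update env x 0) (update (T 0) (f + 1) (unary (env x)))) (S * 2 + 1)
      (store w (O 0) p env (T 0)) := by
    refine runs_moveAll (by simp) (by simpa using hS) ?_
    have : update (T 0) (f + 1) [] = T 0 := by
      rw [← hT 0 (by omega) (f + 1) (by omega), update_eq_self]
    simp [this]
  refine ((he.seq (h1.seq h2)).seq (h3.seq h4)).mono ?_
  have : N * (B + 4) = N * (1 + B + 1) + N * 2 := by ring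
  omega

theorem runs_pushMany (k : Stk) (n : ℕ) (s : Stk → List (Option Letter)) :
    Runs (pushMany k n) s (n + 1) (update s k (unary n ++ s k)) := by
  induction n with
  | zero => simpa [pushMany] using Runs.skip
  | succ n ih =>
    refine (ih.seq (.push ?_)).mono (T := n + 1 + 1) le_rfl
    simp [List.replicate_succ]

-- Time and value must be bounded together, because the values of subexpressions are the lengths of
-- loops. Under a bound variable the bound `S` on the environment grows to `S + q(S)`, which
-- explains the composition with `X + q` in the case of `sum`. The value is put on top of what `t`
-- already holds, so that sums and products arise by accumulation.
open Polynomial in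
theorem Expr.exists_runs (e : Expr) : ∃ q : Polynomial ℕ, ∀ (w : List Letter) (S : ℕ),
    w.length ≤ S → ∀ env : ℕ → ℕ, (∀ x, env x ≤ S) → e.eval w env ≤ q.eval S ∧
      ∀ t f T o p, t < f → (∀ j ≥ f, T j = []) →
        Runs (e.comp t f) (store (w.map some) o p env T) (q.eval S)
          (store (w.map some) o p env (update T t (unary (e.eval w env) ++ T t))) := by
  induction e with
  | const c =>
    refine ⟨C (c + 1), fun w S hw env henv => ⟨by simp [eval], fun t f T o p ht hT => ?_⟩⟩
    simpa [comp, eval] using runs_pushMany (.tmp t) c (store (w.map some) o p env T)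
  | var x =>
    refine ⟨X * 6 + 2, fun w S hw env henv => ⟨?_, fun t f T o p ht hT => ?_⟩⟩
    · have := henv x
      simp only [eval, eval_add, eval_mul, eval_X, eval_ofNat]
      omega
    have h1 : Runs (moveAll (.loc x) (.tmp f)) (store (w.map some) o p env T) (S * 2 + 1)
        (store (w.map some) o p (update env x 0) (update T f (unary (env x)))) :=
      runs_moveAll (by simp) (by simpa using henv x) (by simp [hT])
    have h2 := Runs.loop (k := Stk.tmp f) (c := Option.isSome) (N := S)
      (p := .seq (.pop (.tmp f)) (.seq (.push (.loc x) none) (.push (.tmp t) none)))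
      (T := 1 + (1 + 1))
      (fun i => store (w.map some) o p (update env x (env x - i))
        (update (update T f (unary i)) t (unary (env x - i) ++ T t))) (henv x)
      (by simp [ht.ne']) (by simp [ht.ne', List.replicate_succ])
      (fun i hi => Runs.seq (.pop rfl) (Runs.seq (.push rfl) (.push (by
        have h : env x - i = env x - (i + 1) + 1 := by omega
        have h' : ∀ n, (none : Option Letter) :: List.replicate n none = unary (n + 1) :=
          fun _ => rfl
        simp only [update_store_tmp, store_tmp, store_loc, h', update_store_loc, h, update_self,
          update_of_ne ht.ne, update_of_ne ht.ne', update_idem, List.tail_replicate,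
          Nat.add_sub_cancel]
        congr 1
        funext j
        simp only [update_apply]
        split_ifs <;> simp_all [List.replicate_succ]))))
    refine (h1.seq (h2.of_eq ?_ rfl le_rfl)).of_eq rfl ?_ ?_
    · simp only [Nat.sub_self]
      congr 1
      rw [update_comm ht.ne']
      simp
    · simp only [Nat.sub_zero, update_eq_self, eval]
      congr 1
      have : update T f [] = T := by rw [← hT f le_rfl, update_eq_self]
      simp [this]
    · simp only [eval_add, eval_mul, eval_X, eval_ofNat]
      omega
  | len =>
    refine ⟨X * 5 + 2, fun w S hw env henv => ⟨?_, fun t f T o p ht hT => ?_⟩⟩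
    · simp only [eval, eval_add, eval_mul, eval_X, eval_ofNat]
      omega
    have h1 := Runs.loop (k := Stk.inp) (c := Option.isSome) (N := S)
      (p := .seq (.move .inp (.tmp f)) (.push (.tmp t) none)) (T := 1 + 1)
      (fun i => store ((w.drop (w.length - i)).map some) o p env
        (update (update T f ((w.take (w.length - i)).reverse.map some)) t
          (unary (w.length - i) ++ T t))) hw
      (by simp)
      (fun i hi => by
        simp only [store_inp, List.head?_map, List.head?_drop]
        rw [List.getElem?_eq_getElem (by omega)]; rfl)
      (fun i hi => by
        have hlt : w.length - (i + 1) < w.length := by omega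
        have h : w.length - i = w.length - (i + 1) + 1 := by omega
        refine Runs.seq (.move_cons (a := some w[w.length - (i + 1)])
          (l := (w.drop (w.length - i)).map some) ?_ rfl) (.push ?_)
        · rw [store_inp, List.drop_eq_getElem_cons hlt, ← h, List.map_cons]
        · simp only [update_store_inp, update_store_tmp, store_tmp, update_self,
            update_of_ne ht.ne, update_of_ne ht.ne']
          congr 1
          rw [h, List.take_succ_eq_append_getElem hlt, List.reverse_append]
          funext j
          simp only [update_apply]
          split_ifs <;> first | omega | rfl)
    have h2 : Runs (moveAll (.tmp f) .inp) (store ([].map some) o p env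
        (update (update T f (w.reverse.map some)) t (unary w.length ++ T t))) (S * 2 + 1)
        (store (w.map some) o p env (update T t (unary w.length ++ T t))) := by
      refine runs_moveAll (by simp) (by simpa [ht.ne'] using hw) ?_
      have : update (update (update T f (w.reverse.map some)) t (unary w.length ++ T t)) f [] =
          update T t (unary w.length ++ T t) := by
        rw [update_comm ht.ne', update_idem, update_comm ht.ne, ← hT f le_rfl, update_eq_self]
      simp [ht.ne', this, ← List.map_reverse]
    refine (h1.seq (h2.of_eq (by simp) rfl le_rfl)).of_eq ?_ rfl ?_
    · have : update T f [] = T := by rw [← hT f le_rfl, update_eq_self]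
      simp [this]
    · simp only [eval_add, eval_mul, eval_X, eval_ofNat]
      omega
  | add e e' ih ih' =>
    obtain ⟨q, hq⟩ := ih
    obtain ⟨q', hq'⟩ := ih'
    refine ⟨q + q', fun w S hw env henv => ?_⟩
    obtain ⟨h1, h2⟩ := hq w S hw env henv
    obtain ⟨h1', h2'⟩ := hq' w S hw env henv
    refine ⟨by simpa [eval] using Nat.add_le_add h1 h1', fun t f T o p ht hT => ?_⟩
    refine ((h2 t f T o p ht hT).seq (h2' t f _ o p ht fun j hj => ?_)).of_eq rfl ?_ ?_
    · rw [update_of_ne (by omega), hT j hj]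
    · simp only [eval, update_self, update_idem, unary_append, Nat.add_comm (e.eval w env)]
    · simp
  | mul e e' ih ih' =>
    obtain ⟨q, hq⟩ := ih
    obtain ⟨q', hq'⟩ := ih'
    refine ⟨q + q * (q' + 2) + 1, fun w S hw env henv => ?_⟩
    obtain ⟨h1, h2⟩ := hq w S hw env henv
    obtain ⟨h1', h2'⟩ := hq' w S hw env henv
    have h0 := Nat.mul_le_mul h1 h1'
    refine ⟨?_, fun t f T o p ht hT => ?_⟩
    · simp only [eval, eval_add, eval_mul, eval_one, eval_ofNat, mul_add]
      omega
    have h3 := Runs.loop (k := Stk.tmp f) (c := Option.isSome)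
      (p := .seq (.pop (.tmp f)) (e'.comp t (f + 1))) (T := 1 + q'.eval S)
      (fun i => store (w.map some) o p env (update (update T f (unary i)) t
        (unary ((e.eval w env - i) * e'.eval w env) ++ T t))) h1
      (by simp [ht.ne']) (by simp [ht.ne', List.replicate_succ])
      (fun i hi => by
        have h : e.eval w env - i = e.eval w env - (i + 1) + 1 := by omega
        refine Runs.seq (.pop rfl) ((h2' t (f + 1) (update (update T f (unary i)) t
          (unary ((e.eval w env - (i + 1)) * e'.eval w env) ++ T t)) o p (by omega)
          fun j hj => ?_).of_eq ?_ ?_ le_rfl)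
        · rw [update_of_ne (by omega), update_of_ne (by omega), hT j (by omega)]
        · simp only [update_store_tmp, store_tmp, update_self, update_of_ne ht.ne',
            List.tail_replicate, Nat.add_sub_cancel]
          congr 1
          rw [update_comm ht.ne, update_idem]
        · simp only [update_self, update_idem, unary_append, h, Nat.add_mul, Nat.one_mul,
            Nat.add_comm _ (e'.eval w env)])
    refine ((h2 f (f + 1) T o p (by omega) fun j hj => hT j (by omega)).seq
      (h3.of_eq ?_ rfl le_rfl)).of_eq rfl ?_ ?_
    · simp only [Nat.sub_self, Nat.zero_mul, hT f le_rfl, List.append_nil]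
      congr 1
      rw [update_comm ht.ne']
      simp
    · have : update T f [] = T := by rw [← hT f le_rfl, update_eq_self]
      simp [this, eval]
    · simp only [eval_add, eval_mul, eval_one, eval_ofNat]
      rw [show 1 + q'.eval S + 1 = q'.eval S + 2 by omega]
      omega
  | sub e e' ih ih' =>
    obtain ⟨q, hq⟩ := ih
    obtain ⟨q', hq'⟩ := ih'
    refine ⟨q * 3 + q' * 4 + 2, fun w S hw env henv => ?_⟩
    obtain ⟨h1, h2⟩ := hq w S hw env henv
    obtain ⟨h1', h2'⟩ := hq' w S hw env henv
    refine ⟨?_, fun t f T o p ht hT => ?_⟩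
    · simp only [eval, eval_add, eval_mul, eval_ofNat]
      omega
    set a := e.eval w env
    set b := e'.eval w env
    have hf : f ≠ f + 1 := by omega
    -- Popping an empty stack changes nothing, and this makes the subtraction truncated.
    have h3 := Runs.loop (k := Stk.tmp (f + 1)) (c := Option.isSome)
      (p := .seq (.pop (.tmp (f + 1))) (.pop (.tmp f))) (T := 1 + 1)
      (fun i => store (w.map some) o p env (update (update T f (unary (a - (b - i)))) (f + 1)
        (unary i))) h1'
      (by simp) (by simp [List.replicate_succ])
      (fun i hi => by
        refine Runs.seq (.pop rfl) (.pop ?_)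
        simp only [update_store_tmp, store_tmp, update_self, update_of_ne hf,
            List.tail_replicate, Nat.add_sub_cancel, update_idem]
        congr 1
        rw [update_comm hf.symm, update_idem]
        congr 3
        omega)
    have h4 : Runs (moveAll (.tmp f) (.tmp t)) (store (w.map some) o p env
        (update (update T f (unary (a - b))) (f + 1) (unary 0))) (q.eval S * 2 + 1)
        (store (w.map some) o p env (update T t (unary (a - b) ++ T t))) := by
      refine runs_moveAll (by simp [ht.ne']) (by simp; omega) ?_
      have : update (update (update T f (unary (a - b))) (f + 1) []) f [] = T := by
        funext j
        simp only [update_apply]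
        split_ifs <;> simp_all
      have ht' : t ≠ f + 1 := by omega
      simp [ht.ne, ht', this]
    refine (((h2 f (f + 1) T o p (by omega) fun j hj => hT j (by omega)).seq
      (h2' (f + 1) (f + 2) _ o p (by omega) fun j hj => ?_)).seq
      ((h3.of_eq ?_ rfl le_rfl).seq (h4.of_eq ?_ rfl le_rfl))).of_eq rfl rfl ?_
    · rw [update_of_ne (by omega), hT j (by omega)]
    · simp [hT, a, b]
    · simp
    · simp only [eval_add, eval_mul, eval_ofNat]
      omega
  | read a e ih =>
    obtain ⟨q, hq⟩ := ih
    refine ⟨q * 4 + X * 2 + 5, fun w S hw env henv => ?_⟩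
    obtain ⟨h1, h2⟩ := hq w S hw env henv
    refine ⟨?_, fun t f T o p ht hT => ?_⟩
    · simp only [eval, eval_add, eval_mul, eval_ofNat, eval_X]
      split_ifs <;> omega
    set v := e.eval w env
    have hf : f ≠ f + 1 := by omega
    have h3 := Runs.loop (k := Stk.tmp f) (c := Option.isSome)
      (p := .seq (.pop (.tmp f)) (.move .inp (.tmp (f + 1)))) (T := 1 + 1)
      (fun i => store ((w.drop (v - i)).map some) o p env
        (update (update T f (unary i)) (f + 1) ((w.take (v - i)).reverse.map some))) h1
      (by simp) (by simp [List.replicate_succ])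
      (fun i hi => by
        have h : v - i = v - (i + 1) + 1 := by omega
        refine Runs.seq (s' := store ((w.drop (v - (i + 1))).map some) o p env
          (update (update T f (unary i)) (f + 1) ((w.take (v - (i + 1))).reverse.map some)))
          (.pop ?_) ?_
        · simp only [update_store_tmp, store_tmp, update_of_ne hf, update_self]
          rw [update_comm hf.symm, update_idem]
          rfl
        · by_cases hlt : v - (i + 1) < w.length
          · refine .move_cons (a := some w[v - (i + 1)])
              (l := (w.drop (v - i)).map some) ?_ ?_
            · rw [store_inp, List.drop_eq_getElem_cons hlt, ← h, List.map_cons]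
            · simp only [update_store_inp, update_store_tmp, store_tmp, update_self, update_idem]
              congr 2
              rw [h, List.take_succ_eq_append_getElem hlt, List.reverse_append]
              rfl
          -- Past the end of the word `move` does nothing, in agreement with `drop` and `take`.
          · rw [List.drop_eq_nil_of_le (by omega), List.take_of_length_le (by omega),
              List.drop_eq_nil_of_le (by omega), List.take_of_length_le (by omega)]
            exact .move_nil rfl)
    have h4 : Runs (.ite .inp (fun b => decide (b = some (some a))) (.push (.tmp t) none) .skip)
        (store ((w.drop v).map some) o p env
          (update (update T f (unary 0)) (f + 1) ((w.take v).reverse.map some))) 2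
        (store ((w.drop v).map some) o p env
          (update (update T t (unary ((read a e).eval w env) ++ T t)) (f + 1)
            ((w.take v).reverse.map some))) := by
      have h : update T f [] = T := by rw [← hT f le_rfl, update_eq_self]
      by_cases hr : w[v]? = some a
      · refine .ite_true (by simp [hr]) (.push ?_)
        have ht' : t ≠ f + 1 := by omega
        simp [eval, hr, v, h, ht', update_comm ht']
      · refine Runs.ite_false (by simpa using hr) (Runs.skip.of_eq rfl ?_ le_rfl)
        simp [eval, hr, v, h]
    have h5 : Runs (moveAll (.tmp (f + 1)) .inp) (store ((w.drop v).map some) o p env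
          (update (update T t (unary ((read a e).eval w env) ++ T t)) (f + 1)
            ((w.take v).reverse.map some))) (S * 2 + 1)
        (store (w.map some) o p env (update T t (unary ((read a e).eval w env) ++ T t))) := by
      refine runs_moveAll (by simp) (by simp; omega) ?_
      have : update (update T t (unary ((read a e).eval w env) ++ T t)) (f + 1) [] =
          update T t (unary ((read a e).eval w env) ++ T t) := by
        rw [update_eq_self_iff, update_of_ne (by omega), hT _ (by omega)]
      simp only [update_store_tmp, store_tmp, update_self, update_idem, this, store_inp,
        update_store_inp, ← List.map_reverse, List.reverse_reverse, ← List.map_append,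
        List.take_append_drop]
    refine ((h2 f (f + 1) T o p (by omega) fun j hj => hT j (by omega)).seq
      ((h3.of_eq ?_ rfl le_rfl).seq (h4.seq h5))).of_eq rfl rfl ?_
    · have : update (update T f (unary v)) (f + 1) [] = update T f (unary v) := by
        rw [update_eq_self_iff, update_of_ne (by omega), hT _ (by omega)]
      simp [this, hT, v]
    · simp only [eval_add, eval_mul, eval_ofNat, eval_X]
      omega
  | sum x e b ihe ihb =>
    obtain ⟨q, hq⟩ := ihe
    obtain ⟨r, hr⟩ := ihb
    refine ⟨q + X * 4 + q * (r.comp (X + q) + 4) + 4, fun w S hw env henv => ?_⟩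
    obtain ⟨h1, h2⟩ := hq w S hw env henv
    have h3 : ∀ i < e.eval w env, _ := fun i hi => hr w (S + q.eval S) (by omega) (update env x i)
      (fun y => by
        by_cases hy : y = x
        · subst hy; simp; omega
        · simpa [hy] using (henv y).trans (Nat.le_add_right _ _))
    refine ⟨?_, fun t f T o p ht hT => ?_⟩
    · simp only [eval, eval_add, eval_mul, eval_ofNat, eval_X, eval_comp]
      calc _ ≤ ∑ i ∈ Finset.range (e.eval w env), r.eval (S + q.eval S) :=
            Finset.sum_le_sum fun i hi => (h3 i (Finset.mem_range.1 hi)).1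
        _ = e.eval w env * r.eval (S + q.eval S) := by simp
        _ ≤ q.eval S * (r.eval (S + q.eval S) + 4) := by gcongr; omega
        _ ≤ _ := by omega
    have := runs_forDown (x := x) (e := e) (f := f) (body := b.comp t (f + 2))
      (w := w.map some) (p := p) (env := env) (O := fun _ => o)
      -- When the counter has come down to `i`, exactly the summands with index at least `i` have
      -- been added.
      (T := fun i => update T t (unary (∑ j ∈ Finset.Ico i (e.eval w env),
        b.eval w (update env x j)) ++ T t)) h1 (henv x) (fun i hi j hj => by
          rw [update_of_ne (by omega), hT j hj])
      (te := q.eval S) (B := r.eval (S + q.eval S))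
      (by simpa [hT] using h2 f (f + 1) T o p (by omega) fun j hj => hT j (by omega))
      (fun i hi => by
        have ht' : t ≠ f + 1 := by omega
        refine ((h3 i hi).2 t (f + 2) _ o p (by omega) fun j hj => ?_).of_eq rfl ?_ le_rfl
        · rw [update_of_ne (by omega), update_of_ne (by omega), hT j (by omega)]
        · rw [update_comm ht', update_idem, Finset.sum_eq_sum_Ico_succ_bot hi]
          simp only [update_self, unary_append]
          rw [update_comm ht'.symm])
    refine Runs.of_eq this ?_ ?_ ?_
    · simp
    · simp only [eval, Finset.range_eq_Ico]
    · simp only [eval_add, eval_mul, eval_ofNat, eval_X, eval_comp]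
      omega

open Polynomial in
theorem Out.exists_runs (u : Out) : ∃ q : Polynomial ℕ, ∀ (w : List Letter) (S : ℕ),
    w.length ≤ S → ∀ env : ℕ → ℕ, (∀ x, env x ≤ S) →
      ∀ f T o p, (∀ j ≥ f, T j = []) →
        Runs (u.comp f) (store (w.map some) o p env T) (q.eval S)
          (store (w.map some) ((u.eval w env).map some ++ o) p env T) := by
  induction u with
  | nil =>
    exact ⟨1, fun w S hw env henv f T o p hT => by simpa [comp, eval] using Runs.skip⟩
  | emit a =>
    exact ⟨1, fun w S hw env henv f T o p hT => (Runs.push (by simp [eval])).mono (by simp)⟩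
  | append u u' ih ih' =>
    obtain ⟨q, hq⟩ := ih
    obtain ⟨q', hq'⟩ := ih'
    refine ⟨q' + q, fun w S hw env henv f T o p hT => ?_⟩
    exact ((hq' w S hw env henv f T o p hT).seq (hq w S hw env henv f T _ p hT)).of_eq rfl
      (by simp [eval]) (by simp)
  | ite e u u' ih ih' =>
    obtain ⟨r, hr⟩ := e.exists_runs
    obtain ⟨q, hq⟩ := ih
    obtain ⟨q', hq'⟩ := ih'
    refine ⟨r * 3 + q + q' + 2, fun w S hw env henv f T o p hT => ?_⟩
    obtain ⟨h1, h2⟩ := hr w S hw env henv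
    have h3 := h2 f (f + 1) T o p (by omega) fun j hj => hT j (by omega)
    have h0 : update T f [] = T := by rw [← hT f le_rfl, update_eq_self]
    by_cases h : e.eval w env = 0
    · have h4 := hq' w S hw env henv f T o p hT
      rw [h, hT f le_rfl, List.append_nil, show unary 0 = [] from rfl, h0] at h3
      refine (h3.seq (.ite_false (by simp [hT]) h4)).of_eq rfl (by simp [eval, h]) ?_
      simp only [eval_add, eval_mul, eval_ofNat]
      omega
    · have h5 := Runs.loop (k := Stk.tmp f) (c := Option.isSome)
        (p := .pop (.tmp f)) (T := 1)
        (fun i => store (w.map some) o p env (update T f (unary i))) h1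
        (by simp) (by simp [List.replicate_succ]) (fun i hi => .pop (by simp))
      have h4 := hq w S hw env henv f T o p hT
      refine (h3.seq (.ite_true ?_ ((h5.of_eq ?_ ?_ le_rfl).seq h4))).of_eq rfl
        (by simp [eval, h]) ?_
      · obtain ⟨n, hn⟩ := Nat.exists_eq_succ_of_ne_zero h
        simp [hn, List.replicate_succ]
      · simp [hT]
      · simp [h0]
      · simp only [eval_add, eval_mul, eval_ofNat]
        omega
  | iter x e u ih =>
    obtain ⟨q, hq⟩ := e.exists_runs
    obtain ⟨r, hr⟩ := ih
    refine ⟨q + X * 4 + q * (r.comp (X + q) + 4) + 4, fun w S hw env henv f T o p hT => ?_⟩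
    obtain ⟨h1, h2⟩ := hq w S hw env henv
    have h3 : ∀ i < e.eval w env, _ := fun i hi => hr w (S + q.eval S) (by omega) (update env x i)
      (fun y => by
        by_cases hy : y = x
        · subst hy; simp; omega
        · simpa [hy] using (henv y).trans (Nat.le_add_right _ _))
    have hd : (List.range (e.eval w env)).drop (e.eval w env) = [] :=
      List.drop_eq_nil_of_le (by simp)
    have := runs_forDown (x := x) (e := e) (f := f) (body := u.comp (f + 2))
      (w := w.map some) (p := p) (env := env)
      -- When the counter has come down to `i`, the pieces with index at least `i` have been
      -- written, in their final order.
      (O := fun i => (((List.range (e.eval w env)).drop i).flatMap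
        fun i => u.eval w (update env x i)).map some ++ o)
      (T := fun _ => T) h1 (henv x) (fun i hi j hj => hT j hj)
      (te := q.eval S) (B := r.eval (S + q.eval S))
      (by simpa [hT, hd] using h2 f (f + 1) T o p (by omega) fun j hj => hT j (by omega))
      (fun i hi => by
        refine (h3 i hi (f + 2) _ _ p fun j hj => ?_).of_eq rfl ?_ le_rfl
        · rw [update_of_ne (by omega), hT j (by omega)]
        · rw [List.drop_eq_getElem_cons (i := i) (by simpa using hi)]
          simp)
    refine Runs.of_eq this ?_ ?_ ?_
    · simp [hd]
    · simp [eval]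
    · simp only [eval_add, eval_mul, eval_ofNat, eval_X, eval_comp]
      omega

/-- The program that computes `(x, k) ↦ (u(x), k + c)`. -/
def Out.prog (u : Out) (c : ℕ) : Prog Stk (Option Letter) :=
  .seq (.loop .inp (fun b => decide (b = some none)) (.move .inp .par))
    (.seq (u.comp 0) (.seq (.loop .inp Option.isSome (.pop .inp))
      (.seq (moveAll .par .out) (pushMany .out c))))

theorem Out.runs_prog (u : Out) (c : ℕ) : ∃ q : Polynomial ℕ, ∀ (w : List Letter) (k : ℕ),
    Runs (u.prog c) (update (fun _ => []) .inp (encodePair (w, k)))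
      (q.eval (w.length + k))
      (update (fun _ => []) .out (encodePair (u.eval w (fun _ => 0), k + c))) := by
  obtain ⟨q, hq⟩ := u.exists_runs
  refine ⟨q + Polynomial.X * 6 + Polynomial.C (c + 4), fun w k => ?_⟩
  have hi : update (fun _ => []) Stk.inp (encodePair (w, k)) =
      store (unary k ++ w.map some) [] [] (fun _ => 0) (fun _ => []) := by
    funext s; cases s <;> simp [encodePair]
  have ho : update (fun _ => []) Stk.out (encodePair (u.eval w (fun _ => 0), k + c)) =
      store [] (unary c ++ (unary k ++ (u.eval w (fun _ => 0)).map some)) [] (fun _ => 0)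
        (fun _ => []) := by
    rw [unary_append, Nat.add_comm c]
    funext s; cases s <;> simp [encodePair]
  rw [hi, ho]
  have h1 := Runs.loop (k := Stk.inp) (c := fun b => decide (b = some none))
    (p := .move .inp .par) (T := 1) (N := w.length + k) (n := k)
    (fun i => store (unary i ++ w.map some) [] (unary (k - i)) (fun _ => 0) (fun _ => []))
    (by omega) (by cases w <;> simp) (by simp [List.replicate_succ])
    (fun i hi => .move_cons (a := none) (l := unary i ++ w.map some) rfl (by
      have : k - i = k - (i + 1) + 1 := by omega
      simp [this, List.replicate_succ]))
  have h2 := hq w (w.length + k) (by omega) (fun _ => 0) (by simp) 0 (fun _ => []) [] (unary k)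
    (by simp)
  have h3 := Runs.loop (k := Stk.inp) (c := Option.isSome)
    (p := .pop .inp) (T := 1) (N := w.length + k) (n := w.length)
    (fun i => store ((w.drop (w.length - i)).map some)
      ((u.eval w (fun _ => 0)).map some) (unary k) (fun _ => 0) (fun _ => []))
    (by omega) (by simp)
    (fun i hi => by
      simp only [store_inp, List.head?_map, List.head?_drop]
      rw [List.getElem?_eq_getElem (by omega)]; rfl)
    (fun i hi => .pop (by
      have : w.length - i = w.length - (i + 1) + 1 := by omega
      simp [this]))
  have h4 : Runs (moveAll .par .out) (store [] ((u.eval w (fun _ => 0)).map some) (unary k)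
      (fun _ => 0) (fun _ => [])) ((w.length + k) * 2 + 1)
      (store [] (unary k ++ (u.eval w (fun _ => 0)).map some) [] (fun _ => 0) (fun _ => [])) :=
    runs_moveAll (by simp) (by simp) (by simp)
  have h5 := runs_pushMany .out c (store [] (unary k ++ (u.eval w (fun _ => 0)).map some) []
    (fun _ => 0) (fun _ => []))
  refine (h1.seq ((h2.of_eq ?_ rfl le_rfl).seq ((h3.of_eq ?_ rfl le_rfl).seq
    ((h4.of_eq ?_ rfl le_rfl).seq h5)))).of_eq ?_ ?_ ?_
  · simp
  · simp
  · simp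
  · simp
  · simp
  · simp only [Polynomial.eval_add, Polynomial.eval_mul, Polynomial.eval_ofNat,
      Polynomial.eval_X, Polynomial.eval_C]
    omega

/-- A word expression gives a polynomial-time map that increases the parameter by a constant. -/
theorem Out.computableWithin (u : Out) (c : ℕ) : ∃ q : Polynomial ℕ,
    ComputableWithin (fun p => (u.eval p.1 (fun _ => 0), p.2 + c))
      fun p => q.eval (instanceSize p) := by
  obtain ⟨q, hq⟩ := u.runs_prog c
  refine ⟨q + 1, (u.prog c).machine .inp .out, fun p => ?_⟩
  obtain ⟨t, ht, h⟩ := hq p.1 p.2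
  exact h.machine_outputs (by simpa [instanceSize] using ht)

theorem polyTimeFPTReducible_of_out {P Q : ParamProblem Letter} (u : Out) (c : ℕ)
    (h : ∀ p, p ∈ P ↔ (u.eval p.1 (fun _ => 0), p.2 + c) ∈ Q) : PolyTimeFPTReducible P Q :=
  ⟨_, ⟨h, fun k => k + c, Primrec.to_comp (Primrec.nat_add.comp .id (.const c)), fun _ => le_rfl⟩,
    u.computableWithin c⟩

theorem PolyTimeFPTReducible.fptReducible {α : Type} {P Q : ParamProblem α}
    (h : PolyTimeFPTReducible P Q) : FPTReducible P Q := by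
  obtain ⟨R, hR, q, hq⟩ := h
  exact ⟨R, hR, fun _ => 1, Computable.const 1, q, by simpa using hq⟩

/-! ### Triangular sequences -/

/-- The elements `b i` show that `a` is a covering sequence for the incidence relation `J`. -/
def IsTri {α β : Type} (J : α → β → Prop) {k : ℕ} (a : Fin k → α) (b : Fin k → β) : Prop :=
  ∀ i, J (a i) (b i) ∧ ∀ j < i, ¬ J (a j) (b i)

/-- There is a covering sequence of length `k` for the incidence relation `J`. -/
def HasTri {α β : Type} (J : α → β → Prop) (k : ℕ) : Prop :=
  ∃ (a : Fin k → α) (b : Fin k → β), IsTri J a b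

section Tri

variable {α β α' β' V : Type} {J : α → β → Prop} {k m : ℕ}

theorem IsTri.comp {a : Fin m → α} {b : Fin m → β} (h : IsTri J a b) {f : Fin k → Fin m}
    (hf : StrictMono f) : IsTri J (a ∘ f) (b ∘ f) :=
  fun i => ⟨(h (f i)).1, fun j hj => (h (f i)).2 (f j) (hf hj)⟩

theorem HasTri.mono (hk : k ≤ m) (h : HasTri J m) : HasTri J k :=
  let ⟨_, _, h⟩ := h
  ⟨_, _, h.comp (Fin.strictMono_castLE hk)⟩

/-- Only elements occurring in some incident pair need a partner, and a partner need not be unique.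
This allows passing from `Fin n` to `ℕ`, and from edges of a hypergraph to positions in a list with
repetitions. -/
theorem HasTri.of_rel {J' : α' → β' → Prop} (ρ : α → α' → Prop) (τ : β → β' → Prop)
    (hJ : ∀ a b, J a b → (∃ a', ρ a a') ∧ ∃ b', τ b b')
    (h : ∀ a a' b b', ρ a a' → τ b b' → (J a b ↔ J' a' b')) (hT : HasTri J k) : HasTri J' k := by
  obtain ⟨a, b, hT⟩ := hT
  choose f hf using fun i => (hJ _ _ (hT i).1).1
  choose g hg using fun i => (hJ _ _ (hT i).1).2
  exact ⟨f, g, fun i => ⟨(h _ _ _ _ (hf i) (hg i)).1 (hT i).1,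
    fun j hj hJ' => (hT i).2 j hj ((h _ _ _ _ (hf j) (hg i)).2 hJ')⟩⟩

theorem hasTri_iff_of_rel {J' : α' → β' → Prop} (ρ : α → α' → Prop) (τ : β → β' → Prop)
    (hJ : ∀ a b, J a b → (∃ a', ρ a a') ∧ ∃ b', τ b b')
    (hJ' : ∀ a' b', J' a' b' → (∃ a, ρ a a') ∧ ∃ b, τ b b')
    (h : ∀ a a' b b', ρ a a' → τ b b' → (J a b ↔ J' a' b')) : HasTri J k ↔ HasTri J' k :=
  ⟨.of_rel ρ τ hJ h, .of_rel (fun a' a => ρ a a') (fun b' b => τ b b') hJ'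
    fun _ _ _ _ ha hb => (h _ _ _ _ ha hb).symm⟩

/-- Reversing the order of the pairs turns the triangular condition on rows into the one on columns.
-/
theorem HasTri.swap (h : HasTri J k) : HasTri (fun b a => J a b) k := by
  obtain ⟨a, b, h⟩ := h
  exact ⟨b ∘ Fin.rev, a ∘ Fin.rev, fun i => ⟨(h _).1, fun j hj => (h _).2 _ (Fin.rev_lt_rev.2 hj)⟩⟩

theorem hasTri_congr {J' : α → β → Prop} (h : ∀ a b, J a b ↔ J' a b) :
    HasTri J k ↔ HasTri J' k := by
  have : J = J' := by funext a b; exact propext (h a b)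
  rw [this]

theorem IsTri.injective {a : Fin k → α} {b : Fin k → β} (h : IsTri J a b) : Injective a := by
  intro i j hij
  rcases lt_trichotomy i j with hlt | rfl | hlt
  · exact ((h j).2 i hlt (hij ▸ (h j).1)).elim
  · rfl
  · exact ((h i).2 j hlt (hij ▸ (h i).1)).elim

theorem IsTri.cons {a : Fin k → α} {b : Fin k → β} (h : IsTri J a b) {a₀ : α} {b₀ : β}
    (h₀ : J a₀ b₀) (h₁ : ∀ i, ¬ J a₀ (b i)) :
    IsTri J (Fin.cons a₀ a : Fin (k + 1) → α) (Fin.cons b₀ b : Fin (k + 1) → β) := by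
  intro i
  refine Fin.cases ?_ (fun i => ?_) i
  · exact ⟨h₀, fun j hj => (Fin.not_lt_zero j hj).elim⟩
  · refine ⟨(h i).1, fun j => Fin.cases (fun _ => h₁ i) (fun j hj => (h i).2 j ?_) j⟩
    exact Fin.succ_lt_succ_iff.1 hj

theorem IsTri.snoc {a : Fin k → α} {b : Fin k → β} (h : IsTri J a b) {a₀ : α} {b₀ : β}
    (h₀ : J a₀ b₀) (h₁ : ∀ i, ¬ J (a i) b₀) :
    IsTri J (Fin.snoc a a₀ : Fin (k + 1) → α) (Fin.snoc b b₀ : Fin (k + 1) → β) := by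
  intro i
  refine Fin.lastCases ?_ (fun i => ?_) i
  · refine ⟨by simpa using h₀, fun j => Fin.lastCases (fun h => (lt_irrefl _ h).elim)
      (fun j _ => ?_) j⟩
    simpa using h₁ j
  · refine ⟨by simpa using (h i).1, fun j => Fin.lastCases (fun hj => ?_) (fun j hj => ?_) j⟩
    · exact absurd hj (not_lt.2 (Fin.le_last _))
    · simpa using (h i).2 j (Fin.castSucc_lt_castSucc_iff.1 hj)

theorem IsFootprintSeq.comp {N₁ N₂ : V → Set V} {s : Fin m → V} (h : IsFootprintSeq N₁ N₂ s)
    {f : Fin k → Fin m} (hf : StrictMono f) : IsFootprintSeq N₁ N₂ (s ∘ f) := by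
  refine ⟨h.1.comp hf.injective, fun i => ?_⟩
  obtain ⟨u, hu, hu'⟩ := h.2 (f i)
  refine ⟨u, hu, ?_⟩
  simp only [Set.mem_iUnion, not_exists] at hu' ⊢
  exact fun j hj => hu' (f j) (hf hj)

theorem isFootprintSeq_iff {N₁ N₂ : V → Set V} {s : Fin k → V} : IsFootprintSeq N₁ N₂ s ↔
    Injective s ∧ ∃ u : Fin k → V, ∀ i, u i ∈ N₁ (s i) ∧ ∀ j < i, u i ∉ N₂ (s j) := by
  simp only [IsFootprintSeq, Set.Nonempty, Set.mem_sdiff, Set.mem_iUnion, not_exists,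
    exists_prop, not_and]
  rw [Classical.skolem]

/-- When the same neighborhoods are used for covering and for excluding, distinctness is automatic:
a repeated vertex would have its new footprint already covered. -/
theorem isFootprintSeq_self_iff {N : V → Set V} {s : Fin k → V} :
    IsFootprintSeq N N s ↔ ∃ u : Fin k → V, IsTri (fun v u => u ∈ N v) s u := by
  rw [isFootprintSeq_iff]
  exact ⟨fun h => h.2, fun h => ⟨h.choose_spec.injective, h⟩⟩

theorem exists_isFootprintSeq_iff {N : V → Set V} :
    (∃ m ≥ k, ∃ s : Fin m → V, IsFootprintSeq N N s) ↔ HasTri (fun v u => u ∈ N v) k := by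
  simp only [isFootprintSeq_self_iff]
  exact ⟨fun ⟨m, hm, h⟩ => HasTri.mono hm h, fun h => ⟨k, le_rfl, h⟩⟩

/-- L-sequences are the covering sequences of the hypergraph on two copies of the vertex set, in
which `v` covers its open neighborhood in the first copy and its closed neighborhood in the second
one. -/
def lIncidence (G : SimpleGraph V) (v : V) : V ⊕ V → Prop :=
  Sum.elim (fun u => G.Adj v u) (fun u => u = v ∨ G.Adj v u)

/-- A vertex that footprints itself uses the copy with closed neighborhoods; it is not covered there
by an earlier vertex exactly because the vertices are distinct and earlier ones are not adjacent to
it. All other footprints use the copy with open neighborhoods. Conversely the two copies may be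
merged, since avoiding a closed neighborhood implies avoiding the open one. -/
theorem exists_isLSeq_iff {G : SimpleGraph V} :
    (∃ m ≥ k, ∃ s : Fin m → V, IsLSeq G s) ↔ HasTri (lIncidence G) k := by
  constructor
  · rintro ⟨m, hm, s, hs⟩
    obtain ⟨hinj, u, hu⟩ := isFootprintSeq_iff.1 hs
    classical
    refine HasTri.mono hm ⟨s, fun i => if u i = s i then Sum.inr (u i) else Sum.inl (u i),
      fun i => ?_⟩
    have hui : u i = s i ∨ G.Adj (s i) (u i) := (hu i).1
    have huj : ∀ j < i, ¬ G.Adj (s j) (u i) := (hu i).2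
    by_cases h : u i = s i
    · simp only [h, if_true]
      refine ⟨Or.inl rfl, fun j hj hJ => ?_⟩
      rcases hJ with hJ | hJ
      · exact hj.ne (hinj hJ).symm
      · exact huj j hj (h ▸ hJ)
    · simp only [h, if_false]
      exact ⟨hui.resolve_left h, fun j hj => huj j hj⟩
  · rintro ⟨s, u, h⟩
    refine ⟨k, le_rfl, s, isFootprintSeq_iff.2 ⟨h.injective, fun i => (u i).elim id id,
      fun i => ?_⟩⟩
    obtain ⟨h1, h2⟩ := h i
    show (u i).elim id id ∈ closedNbhd G (s i) ∧ ∀ j < i, (u i).elim id id ∉ G.neighborSet (s j)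
    generalize u i = y at h1 h2 ⊢
    rcases y with y | y
    · exact ⟨Or.inr h1, h2⟩
    · exact ⟨h1, fun j hj hJ => h2 j hj (Or.inr hJ)⟩

theorem IsTotalDominatingSeq.isLSeq {G : SimpleGraph V} {s : Fin k → V}
    (h : IsTotalDominatingSeq G s) : IsLSeq G s := by
  obtain ⟨hinj, u, hu⟩ := isFootprintSeq_iff.1 h
  exact isFootprintSeq_iff.2 ⟨hinj, u, fun i => ⟨Or.inr (hu i).1, (hu i).2⟩⟩

end Tri

/-! ### Graphs whose vertices are covered by two cliques -/

/-- `E` and its complement are cliques of `G`, and both have two vertices without neighbors on the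
other side. -/
structure IsCobip {V : Type} (G : SimpleGraph V) (E : V → Prop) : Prop where
  adj : ∀ u v, u ≠ v → (E u ↔ E v) → G.Adj u v
  exists_left : ∃ u v, u ≠ v ∧ E u ∧ E v ∧ ∀ x, ¬ E x → ¬ G.Adj u x ∧ ¬ G.Adj v x
  exists_right : ∃ u v, u ≠ v ∧ ¬ E u ∧ ¬ E v ∧ ∀ x, E x → ¬ G.Adj u x ∧ ¬ G.Adj v x

/-- The edges of `G` between `E` and its complement. -/
def crossAdj {V : Type} (G : SimpleGraph V) (E : V → Prop) (v u : V) : Prop :=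
  E v ∧ ¬ E u ∧ G.Adj v u

namespace IsCobip

variable {V : Type} {G : SimpleGraph V} {E : V → Prop} {k : ℕ}

theorem compl (h : IsCobip G E) : IsCobip G (fun v => ¬ E v) where
  adj u v huv hE := h.adj u v huv (not_iff_not.1 hE)
  exists_left := by
    obtain ⟨u, v, h1, h2, h3, h4⟩ := h.exists_right
    exact ⟨u, v, h1, h2, h3, fun x hx => h4 x (not_not.1 hx)⟩
  exists_right := by
    obtain ⟨u, v, h1, h2, h3, h4⟩ := h.exists_left
    exact ⟨u, v, h1, not_not.2 h2, not_not.2 h3, h4⟩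

/-- Exchanging the two cliques transposes the cross relation. Together with `compl` this permits the
assumption that the first vertex of a sequence lies in `E`. -/
theorem hasTri_compl (h : HasTri (crossAdj G fun v => ¬ E v) k) : HasTri (crossAdj G E) k :=
  (hasTri_congr fun v u => by simp only [crossAdj, G.adj_comm u v]; tauto).1 h.swap

theorem noIsolated (h : IsCobip G E) : NoIsolated G := by
  intro v hv
  by_cases hE : E v
  · obtain ⟨a, b, hab, ha, hb, -⟩ := h.exists_left
    by_cases hva : v = a
    · exact hv b (h.adj _ _ (hva ▸ hab) (by tauto))
    · exact hv a (h.adj _ _ hva (by tauto))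
  · obtain ⟨a, b, hab, ha, hb, -⟩ := h.exists_right
    by_cases hva : v = a
    · exact hv b (h.adj _ _ (hva ▸ hab) (by tauto))
    · exact hv a (h.adj _ _ hva (by tauto))

/-- Let `v 0` lie in `E`. It dominates `E`, so all later footprints lie outside `E`. A vertex
outside `E` before the last position would dominate the rest and leave nothing for the last one.
Deleting the first and last positions therefore leaves rows in `E` and footprints outside. -/
theorem hasTri_cross_of_closedNbhd (h : IsCobip G E)
    (hT : HasTri (fun v u => u ∈ closedNbhd G v) (k + 2)) : HasTri (crossAdj G E) k := by
  obtain ⟨v, u, hT⟩ := hT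
  wlog hv : E (v 0) generalizing E
  · exact hasTri_compl (this h.compl hv)
  have hcl : ∀ x y, (E x ↔ E y) → y ∈ closedNbhd G x := fun x y hxy => by
    by_cases hne : y = x
    · exact Or.inl hne
    · exact Or.inr (h.adj _ _ (Ne.symm hne) hxy)
  have hE : ∀ i : Fin (k + 2), i < Fin.last _ → E (v i) := by
    intro i hi
    by_contra hvi
    by_cases hu : E (u (Fin.last _))
    · exact (hT (Fin.last _)).2 0 (Fin.last_pos) (hcl _ _ (by tauto))
    · exact (hT (Fin.last _)).2 i hi (hcl _ _ (by tauto))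
  have hu : ∀ i : Fin (k + 2), 0 < i → ¬ E (u i) := fun i hi hui =>
    (hT i).2 0 hi (hcl _ _ (by tauto))
  refine ⟨fun i => v i.succ.castSucc, fun i => u i.succ.castSucc, fun i => ?_⟩
  have h1 := hE i.succ.castSucc (Fin.castSucc_lt_last _)
  have h2 := hu i.succ.castSucc (by simp [Fin.lt_def])
  refine ⟨⟨h1, h2, ?_⟩, fun j hj hJ => ?_⟩
  · rcases (hT i.succ.castSucc).1 with h3 | h3
    · exact (h2 (by rw [h3]; exact h1)).elim
    · exact h3
  · exact (hT i.succ.castSucc).2 j.succ.castSucc (by simpa using hj) (Or.inr hJ.2.2)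

/-- One vertex of each clique without neighbors on the other side is added: `e` at the beginning and
`x` at the end, each footprinting itself. -/
theorem hasTri_closedNbhd (h : IsCobip G E) (hT : HasTri (crossAdj G E) k) :
    HasTri (fun v u => u ∈ closedNbhd G v) (k + 2) := by
  obtain ⟨a, b, hT⟩ := hT
  obtain ⟨e, _, -, he, -, he'⟩ := h.exists_left
  obtain ⟨x, _, -, hx, -, hx'⟩ := h.exists_right
  have hab : IsTri (fun v u => u ∈ closedNbhd G v) a b := fun i =>
    ⟨Or.inr (hT i).1.2.2, fun j hj hJ => by
      rcases hJ with hJ | hJ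
      · exact (hT i).1.2.1 (hJ ▸ (hT j).1.1)
      · exact (hT i).2 j hj ⟨(hT j).1.1, (hT i).1.2.1, hJ⟩⟩
  have hnot : ∀ y, ¬ E y → y ∉ closedNbhd G e := by
    rintro y hy (rfl | hJ)
    · exact hy he
    · exact (he' y hy).1 hJ
  refine ⟨_, _, (hab.snoc (a₀ := x) (b₀ := x) (Or.inl rfl) fun i hJ => ?_).cons
    (a₀ := e) (b₀ := e) (Or.inl rfl) fun i => ?_⟩
  · rcases hJ with hJ | hJ
    · exact hx (hJ ▸ (hT i).1.1)
    · exact (hx' _ (hT i).1.1).1 hJ.symm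
  · refine Fin.lastCases ?_ (fun i => ?_) i
    · rw [Fin.snoc_last]
      exact hnot x hx
    · rw [Fin.snoc_castSucc]
      exact hnot _ (hT i).1.2.1

/-- A vertex cannot footprint itself here, so each end needs a pair of vertices without neighbors on
the other side. The rows `e, e', a, x, x'` have the footprints `e', e, b, x', x`. -/
theorem hasTri_adj (h : IsCobip G E) (hT : HasTri (crossAdj G E) k) :
    HasTri G.Adj (k + 4) := by
  obtain ⟨a, b, hT⟩ := hT
  obtain ⟨e, e', hne, he, he', hadj⟩ := h.exists_left
  obtain ⟨x, x', hnx, hx, hx', hadj'⟩ := h.exists_right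
  have hab : IsTri G.Adj a b := fun i =>
    ⟨(hT i).1.2.2, fun j hj hJ => (hT i).2 j hj ⟨(hT j).1.1, (hT i).1.2.1, hJ⟩⟩
  have h1 := hab.snoc (a₀ := x) (b₀ := x') (h.adj _ _ hnx (by tauto))
    fun i hJ => (hadj' _ (hT i).1.1).2 hJ.symm
  have h2 := h1.snoc (a₀ := x') (b₀ := x) (h.adj _ _ hnx.symm (by tauto)) fun i => by
    refine Fin.lastCases ?_ (fun i => ?_) i
    · simp
    · rw [Fin.snoc_castSucc]
      exact fun hJ => (hadj' _ (hT i).1.1).1 hJ.symm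
  have hb : ∀ i, ¬ E ((Fin.snoc (Fin.snoc b x' : Fin (k + 1) → V) x : Fin (k + 2) → V) i) := by
    intro i
    refine Fin.lastCases ?_ (fun i => Fin.lastCases ?_ (fun i => ?_) i) i
    · simpa using hx
    · simpa using hx'
    · simpa using (hT i).1.2.1
  have h3 := h2.cons (a₀ := e') (b₀ := e) (h.adj _ _ hne.symm (by tauto))
    fun i => (hadj _ (hb i)).2
  refine ⟨_, _, h3.cons (a₀ := e) (b₀ := e') (h.adj _ _ hne (by tauto)) fun i => ?_⟩
  refine Fin.cases ?_ (fun i => ?_) i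
  · simp
  · exact (hadj _ (hb i)).1

/-- A chosen vertex excludes its clique except for itself, so a second vertex of the same clique is
needed to finish the clique off. This costs two positions at the beginning and two at the end; the
positions from `2` to `k + 1` form the cross sequence. The bound serves total dominating sequences
as well, since they are L-sequences. -/
theorem hasTri_cross_of_isLSeq (h : IsCobip G E) {v : Fin (k + 4) → V} (hL : IsLSeq G v) :
    HasTri (crossAdj G E) k := by
  obtain ⟨hinj, u, hu⟩ := isFootprintSeq_iff.1 hL
  -- The case `k = 0` is separated because the argument below uses position `4`.
  rcases Nat.eq_zero_or_pos k with rfl | hk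
  · exact ⟨Fin.elim0, Fin.elim0, fun i => i.elim0⟩
  wlog hv : E (v 0) generalizing E
  · exact hasTri_compl (this h.compl hv)
  have hself : ∀ i l, i < l → u i ≠ v i → u l ≠ u i := fun i l hl hne he =>
    (hu l).2 i hl (he ▸ (hu i).1.resolve_left hne)
  have hlater : ∀ i l, i < l → (E (v i) ↔ E (u l)) → u l = v i := fun i l hl hE => by
    by_contra hne
    exact (hu l).2 i hl (h.adj _ _ (Ne.symm hne) hE)
  -- If the first two vertices lay in different cliques, only these two could be later footprints.
  -- Being footprints of other vertices, they could each be used once, but positions `2`, `3`, `4`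
  -- need three.
  have hv1 : E (v ⟨1, by omega⟩) := by
    by_contra hv1
    have hmem : ∀ l : Fin (k + 4), 2 ≤ l.1 → (u l = v 0 ∨ u l = v ⟨1, by omega⟩) ∧ u l ≠ v l := by
      intro l hl
      have h0 := hlater 0 l (by rw [Fin.lt_def]; exact Nat.lt_of_lt_of_le two_pos hl)
      have h1 := hlater ⟨1, by omega⟩ l (by rw [Fin.lt_def]; exact hl)
      have : u l = v 0 ∨ u l = v ⟨1, by omega⟩ := by tauto
      refine ⟨this, fun hul => ?_⟩
      rcases this with h2 | h2
      · have : l.1 = 0 := congrArg Fin.val (hinj (hul.symm.trans h2))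
        omega
      · have : l.1 = 1 := congrArg Fin.val (hinj (hul.symm.trans h2))
        omega
    have h2 := hmem ⟨2, by omega⟩ le_rfl
    have h3 := hmem ⟨3, by omega⟩ (by simp)
    have h4 := hmem ⟨4, by omega⟩ (by simp)
    have h23 := hself ⟨2, by omega⟩ ⟨3, by omega⟩ (by simp [Fin.lt_def]) h2.2
    have h24 := hself ⟨2, by omega⟩ ⟨4, by omega⟩ (by simp [Fin.lt_def]) h2.2
    have h34 := hself ⟨3, by omega⟩ ⟨4, by omega⟩ (by simp [Fin.lt_def]) h3.2
    rcases h2.1 with h2 | h2 <;> rcases h3.1 with h3 | h3 <;> rcases h4.1 with h4 | h4 <;>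
      simp_all
  have h01 : v 0 ≠ v ⟨1, by omega⟩ := fun he => by
    have := congrArg Fin.val (hinj he)
    simp at this
  -- The second vertex of `E` excludes `v 0`, the only vertex of `E` left uncovered by the first.
  have hne0 : ∀ l : Fin (k + 4), 2 ≤ l.1 → u l ≠ v 0 := fun l hl he =>
    (hu l).2 ⟨1, by omega⟩ (by rw [Fin.lt_def]; exact hl)
      (he ▸ h.adj _ _ h01.symm (by tauto))
  have hul : ∀ l : Fin (k + 4), 2 ≤ l.1 → ¬ E (u l) := fun l hl hE =>
    hne0 l hl (hlater 0 l (by rw [Fin.lt_def]; exact Nat.lt_of_lt_of_le two_pos hl) (by tauto))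
  -- If `v i` were outside `E`, both of the next two positions would have `v i` as footprint,
  -- although the first of them already covers it.
  have hE : ∀ i : Fin (k + 4), 2 ≤ i.1 → i.1 < k + 2 → E (v i) := by
    intro i hi hik
    by_contra hvi
    have h1 := hlater i ⟨i + 1, by omega⟩ (by simp [Fin.lt_def])
      (by have := hul ⟨i + 1, by omega⟩ (by simp; omega); tauto)
    have h2 := hlater i ⟨i + 2, by omega⟩ (by simp [Fin.lt_def])
      (by have := hul ⟨i + 2, by omega⟩ (Nat.le_add_left 2 _); tauto)
    refine hself ⟨i + 1, by omega⟩ ⟨i + 2, by omega⟩ (by simp [Fin.lt_def]) (fun h3 => ?_)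
      (h2.trans h1.symm)
    have := congrArg Fin.val (hinj (h1.symm.trans h3))
    simp at this
  refine ⟨fun i => v ⟨i + 2, by omega⟩, fun i => u ⟨i + 2, by omega⟩, fun i => ?_⟩
  have h1 := hE ⟨i + 2, by omega⟩ (Nat.le_add_left 2 _) (by simp)
  have h2 := hul ⟨i + 2, by omega⟩ (Nat.le_add_left 2 _)
  refine ⟨⟨h1, h2, (hu _).1.resolve_left fun h3 => h2 (h3 ▸ h1)⟩, fun j hj hJ => ?_⟩
  exact (hu ⟨i + 2, by omega⟩).2 ⟨j + 2, by omega⟩ (Nat.add_lt_add_right hj 2) hJ.2.2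

theorem exists_isDominatingSeq_iff (h : IsCobip G E) :
    (∃ m ≥ k + 2, ∃ s : Fin m → V, IsDominatingSeq G s) ↔ HasTri (crossAdj G E) k :=
  exists_isFootprintSeq_iff.trans ⟨h.hasTri_cross_of_closedNbhd, h.hasTri_closedNbhd⟩

theorem exists_isLSeq_iff (h : IsCobip G E) :
    (∃ m ≥ k + 4, ∃ s : Fin m → V, IsLSeq G s) ↔ HasTri (crossAdj G E) k := by
  constructor
  · rintro ⟨m, hm, s, hs⟩
    exact h.hasTri_cross_of_isLSeq (hs.comp (Fin.strictMono_castLE hm))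
  · intro hT
    obtain ⟨m, hm, s, hs⟩ := exists_isFootprintSeq_iff.2 (h.hasTri_adj hT)
    exact ⟨m, hm, s, IsTotalDominatingSeq.isLSeq hs⟩

theorem exists_isTotalDominatingSeq_iff (h : IsCobip G E) :
    (∃ m ≥ k + 4, ∃ s : Fin m → V, IsTotalDominatingSeq G s) ↔ HasTri (crossAdj G E) k := by
  constructor
  · rintro ⟨m, hm, s, hs⟩
    exact h.exists_isLSeq_iff.1 ⟨m, hm, s, hs.isLSeq⟩
  · exact fun hT => exists_isFootprintSeq_iff.2 (h.hasTri_adj hT)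

theorem hasTri_adj_iff (h : IsCobip G E) : HasTri G.Adj (k + 4) ↔ HasTri (crossAdj G E) k :=
  exists_isFootprintSeq_iff.symm.trans h.exists_isTotalDominatingSeq_iff

end IsCobip

/-! ### 0-1 matrices as words -/

open Classical in
/-- The letter for an entry of a 0-1 matrix. -/
def bitLetter (P : Prop) : Letter := if P then .one else .zero

/-- A row of length `c`. -/
def rowWord (c : ℕ) (P : ℕ → Prop) : List Letter :=
  (List.range c).map (fun j => bitLetter (P j)) ++ [.sep]

/-- A matrix with `r` rows of length `c`. -/
def matWord (r c : ℕ) (P : ℕ → ℕ → Prop) : List Letter :=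
  (List.range r).flatMap fun i => rowWord c (P i)

/-- The entry `1` is at position `(i, j)` of the matrix with rows of length `c`. -/
def Entry (w : List Letter) (c i j : ℕ) : Prop := w[i * (c + 1) + j]? = some .one

/-- The word is a 0-1 matrix with `r` rows of length `c`. -/
def IsMat (w : List Letter) (r c : ℕ) : Prop :=
  w.length = r * (c + 1) ∧ ∀ i < r, w[i * (c + 1) + c]? = some .sep ∧
    ∀ j < c, w[i * (c + 1) + j]? = some .one ∨ w[i * (c + 1) + j]? = some .zero

open Classical in
/-- The position of the first separator, which is the length of the rows. -/
def width (w : List Letter) : ℕ :=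
  ∑ x ∈ Finset.range w.length,
    if w[x]? = some .sep ∧ ∀ y < x, w[y]? ≠ some .sep then x else 0

theorem length_rowWord (c : ℕ) (P : ℕ → Prop) : (rowWord c P).length = c + 1 := by
  simp [rowWord]

theorem matWord_succ (r c : ℕ) (P : ℕ → ℕ → Prop) :
    matWord (r + 1) c P = rowWord c (P 0) ++ matWord r c (fun i => P (i + 1)) := by
  simp [matWord, List.range_succ_eq_map, List.flatMap_map]

theorem length_matWord (r c : ℕ) (P : ℕ → ℕ → Prop) :
    (matWord r c P).length = r * (c + 1) := by
  induction r generalizing P with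
  | zero => simp [matWord]
  | succ r ih => rw [matWord_succ, List.length_append, ih, length_rowWord]; ring

theorem getElem?_matWord (r c : ℕ) (P : ℕ → ℕ → Prop) {i j : ℕ} (hi : i < r) (hj : j ≤ c) :
    (matWord r c P)[i * (c + 1) + j]? = (rowWord c (P i))[j]? := by
  induction r generalizing P i with
  | zero => omega
  | succ r ih =>
    rw [matWord_succ]
    cases i with
    | zero =>
      rw [List.getElem?_append_left (by rw [length_rowWord]; omega)]
      simp
    | succ i =>
      rw [List.getElem?_append_right (by rw [length_rowWord, Nat.add_mul]; omega),
        length_rowWord, ← ih (fun i => P (i + 1)) (by omega)]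
      congr 1
      rw [Nat.add_mul]
      omega

theorem getElem?_rowWord_of_lt (c : ℕ) (P : ℕ → Prop) {j : ℕ} (hj : j < c) :
    (rowWord c P)[j]? = some (bitLetter (P j)) := by
  rw [rowWord, List.getElem?_append_left (by simpa using hj)]
  simp [hj]

theorem getElem?_rowWord_self (c : ℕ) (P : ℕ → Prop) : (rowWord c P)[c]? = some .sep := by
  simp [rowWord]

theorem isMat_matWord (r c : ℕ) (P : ℕ → ℕ → Prop) : IsMat (matWord r c P) r c := by
  refine ⟨length_matWord r c P, fun i hi => ⟨?_, fun j hj => ?_⟩⟩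
  · rw [getElem?_matWord r c P hi le_rfl, getElem?_rowWord_self]
  · rw [getElem?_matWord r c P hi hj.le, getElem?_rowWord_of_lt c _ hj, bitLetter]
    split_ifs <;> simp

theorem entry_matWord {r c : ℕ} {P : ℕ → ℕ → Prop} {i j : ℕ} (hi : i < r) (hj : j < c) :
    Entry (matWord r c P) c i j ↔ P i j := by
  rw [Entry, getElem?_matWord r c P hi hj.le, getElem?_rowWord_of_lt c _ hj, bitLetter]
  split_ifs with h <;> simp [h]

theorem matWord_congr {r c : ℕ} {P P' : ℕ → ℕ → Prop} (h : ∀ i < r, ∀ j < c, P i j ↔ P' i j) :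
    matWord r c P = matWord r c P' := by
  simp only [matWord, rowWord]
  refine List.flatMap_congr fun i hi => ?_
  congr 1
  refine List.map_congr_left fun j hj => ?_
  rw [propext (h i (List.mem_range.1 hi) j (List.mem_range.1 hj))]

/-- A well-formed word is recovered from its entries by division with remainder of the positions by
`c + 1`. This turns the syntactic conditions on a word into the existence of an encoded object. -/
theorem IsMat.eq_matWord {w : List Letter} {r c : ℕ} (h : IsMat w r c) :
    w = matWord r c (Entry w c) := by
  refine List.ext_getElem? fun x => ?_
  by_cases hx : x < w.length
  · have hc : 0 < c + 1 := Nat.succ_pos c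
    obtain ⟨i, j, hi, hj, rfl⟩ : ∃ i j, i < r ∧ j ≤ c ∧ x = i * (c + 1) + j :=
      ⟨x / (c + 1), x % (c + 1), by rw [Nat.div_lt_iff_lt_mul hc, ← h.1]; exact hx,
        Nat.le_of_lt_succ (Nat.mod_lt _ hc), (Nat.div_add_mod' x (c + 1)).symm⟩
    rw [getElem?_matWord r c _ hi hj]
    rcases hj.lt_or_eq with hj | rfl
    · rw [getElem?_rowWord_of_lt c _ hj, bitLetter, Entry]
      rcases (h.2 _ hi).2 _ hj with h2 | h2 <;> simp [h2]
    · rw [getElem?_rowWord_self, (h.2 _ hi).1]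
  · rw [List.getElem?_eq_none (by omega), List.getElem?_eq_none]
    rw [length_matWord, ← h.1]; omega

theorem IsMat.width_eq {w : List Letter} {r c : ℕ} (h : IsMat w r c) (hr : 0 < r) :
    width w = c := by
  have h0 := h.2 0 hr
  simp only [Nat.zero_mul, Nat.zero_add] at h0
  have hc : c < w.length := by
    by_contra hc
    rw [List.getElem?_eq_none (by omega)] at h0
    simp at h0
  have hne : ∀ y < c, w[y]? ≠ some .sep := fun y hy => by
    rcases h0.2 y hy with h | h <;> simp [h]
  rw [width, Finset.sum_eq_single c]
  · rw [if_pos ⟨h0.1, hne⟩]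
  · intro x _ hx
    rw [if_neg]
    rintro ⟨h1, h2⟩
    rcases lt_or_gt_of_ne hx with hx | hx
    · exact hne x hx h1
    · exact h2 c hx h0.1
  · simp [hc]

theorem width_nil : width [] = 0 := by simp [width]

/-- Every row ends in a separator, so this word is a fixed no-instance of all five problems. -/
theorem not_isMat_zero (r c : ℕ) : ¬ IsMat [.zero] r c := by
  intro h
  have h1 : 1 = r * (c + 1) := h.1
  have hr : r = 1 := Nat.eq_one_of_mul_eq_one_right h1.symm
  subst hr
  have hc : c = 0 := by omega
  subst hc
  have := (h.2 0 one_pos).1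
  simp at this

/-! ### The encodings of the instances -/

theorem encodeRow_eq {n : ℕ} (r : Fin n → Prop) :
    encodeRow r = rowWord n (fun j => ∃ h : j < n, r ⟨j, h⟩) := by
  rw [encodeRow, rowWord]
  congr 1
  refine List.ext_getElem (by simp) fun j h1 h2 => ?_
  have hj : j < n := by simpa using h1
  have hr : (∃ h : j < n, r ⟨j, h⟩) ↔ r ⟨j, hj⟩ := by simp [hj]
  rw [List.getElem_ofFn, List.getElem_map, List.getElem_range, propext hr]
  rfl

theorem encodeGraph_eq {n : ℕ} (G : SimpleGraph (Fin n)) : encodeGraph G =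
    matWord n n (fun i j => ∃ (hi : i < n) (hj : j < n), G.Adj ⟨i, hi⟩ ⟨j, hj⟩) := by
  rw [encodeGraph, matWord, List.flatMap_def]
  congr 1
  refine List.ext_getElem (by simp) fun i h1 h2 => ?_
  have hi : i < n := by simpa using h1
  simp [encodeRow_eq, hi]

theorem encodeGraphWithSet_eq {n : ℕ} (G : SimpleGraph (Fin n)) (A : Set (Fin n)) :
    encodeGraphWithSet G A = matWord (n + 1) n (fun i j =>
      (i = 0 ∧ ∃ h : j < n, ⟨j, h⟩ ∈ A) ∨
      (i ≠ 0 ∧ ∃ (hi : i - 1 < n) (hj : j < n), G.Adj ⟨i - 1, hi⟩ ⟨j, hj⟩)) := by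
  rw [matWord_succ, encodeGraphWithSet, encodeRow_eq, encodeGraph_eq]
  simp

theorem encodeHypergraph_eq (n : ℕ) (l : List (Set (Fin n))) :
    encodeHypergraph n l = matWord (l.length + 1) n (fun i j =>
      i = 0 ∨ ∃ e, (l[i - 1]? = some e ∧ ∃ h : j < n, ⟨j, h⟩ ∈ e)) := by
  rw [matWord_succ, encodeHypergraph, encodeRow_eq]
  congr 1
  · simp only [rowWord, true_or]
    congr 1
    refine List.map_congr_left fun j hj => ?_
    have : j < n := List.mem_range.1 hj
    simp [bitLetter, this]
  · rw [matWord, List.flatMap_def, List.flatMap_def]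
    congr 1
    refine List.ext_getElem (by simp) fun i h1 h2 => ?_
    have hi : i < l.length := by simpa using h1
    simp [encodeRow_eq, hi]

/-! ### Membership in the five problems in terms of triangular sequences -/

/-- The word contains the adjacency matrix of a graph without isolated vertices on `c` vertices,
after `o` further rows. -/
def GraphMat (w : List Letter) (c o : ℕ) : Prop :=
  IsMat w (c + o) c ∧ ∀ i < c, ¬ Entry w c (i + o) i ∧
    (∀ j < c, Entry w c (i + o) j → Entry w c (j + o) i) ∧ ∃ j < c, Entry w c (i + o) j

theorem GraphMat.exists_graph {w : List Letter} {c o : ℕ} (h : GraphMat w c o) :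
    ∃ G : SimpleGraph (Fin c), (∀ i j, G.Adj i j ↔ Entry w c (i + o) j) ∧ NoIsolated G := by
  refine ⟨⟨fun i j => Entry w c (i + o) j, ⟨fun i j hij => ?_⟩, ⟨fun i hi => ?_⟩⟩,
    fun i j => Iff.rfl, fun i hi => ?_⟩
  · exact (h.2 i i.2).2.1 j j.2 hij
  · exact (h.2 i i.2).1 hi
  · obtain ⟨j, hj, hij⟩ := (h.2 i i.2).2.2
    exact hi ⟨j, hj⟩ hij

theorem graphMat_of_graph {n o : ℕ} {w : List Letter} (G : SimpleGraph (Fin n))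
    (hw : IsMat w (n + o) n) (hG : ∀ i j : Fin n, G.Adj i j ↔ Entry w n (i + o) j)
    (h : NoIsolated G) : GraphMat w n o := by
  refine ⟨hw, fun i hi => ⟨fun hii => ?_, fun j hj hij => ?_, ?_⟩⟩
  · exact G.irrefl ((hG ⟨i, hi⟩ ⟨i, hi⟩).2 hii)
  · exact (hG ⟨j, hj⟩ ⟨i, hi⟩).1 ((hG ⟨i, hi⟩ ⟨j, hj⟩).2 hij).symm
  · have := h ⟨i, hi⟩
    simp only [SimpleGraph.IsIsolated, not_forall, not_not] at this
    obtain ⟨j, hj⟩ := this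
    exact ⟨j, j.2, (hG ⟨i, hi⟩ j).1 hj⟩

theorem isMat_encodeGraph {n : ℕ} (G : SimpleGraph (Fin n)) : IsMat (encodeGraph G) n n := by
  rw [encodeGraph_eq]; exact isMat_matWord ..

theorem width_encodeGraph {n : ℕ} (G : SimpleGraph (Fin n)) : width (encodeGraph G) = n := by
  rcases Nat.eq_zero_or_pos n with rfl | hn
  · simp [encodeGraph, width_nil]
  · exact (isMat_encodeGraph G).width_eq hn

theorem entry_encodeGraph {n : ℕ} (G : SimpleGraph (Fin n)) (i j : Fin n) :
    Entry (encodeGraph G) n i j ↔ G.Adj i j := by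
  rw [encodeGraph_eq, entry_matWord i.2 j.2]
  simp

/-- The encoding is injective: the width gives the number of vertices and the entries give the
edges. -/
theorem exists_encodeGraph_iff {n : ℕ} {G : SimpleGraph (Fin n)}
    {Φ : ∀ n, SimpleGraph (Fin n) → Prop} :
    (∃ (n' : ℕ) (G' : SimpleGraph (Fin n')), encodeGraph G = encodeGraph G' ∧ Φ n' G') ↔
      Φ n G := by
  refine ⟨?_, fun h => ⟨n, G, rfl, h⟩⟩
  rintro ⟨n', G', he, h⟩
  obtain rfl : n = n' := by rw [← width_encodeGraph G, he, width_encodeGraph]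
  obtain rfl : G = G' := by
    ext i j
    rw [← entry_encodeGraph, he, entry_encodeGraph]
  exact h

theorem graphMat_iff {w : List Letter} : GraphMat w (width w) 0 ↔
    ∃ (n : ℕ) (G : SimpleGraph (Fin n)), w = encodeGraph G ∧ NoIsolated G := by
  constructor
  · intro h
    obtain ⟨G, hG, hn⟩ := h.exists_graph
    refine ⟨_, G, ?_, hn⟩
    rw [encodeGraph_eq]
    nth_rw 1 [IsMat.eq_matWord h.1]
    refine matWord_congr fun i hi j hj => ?_
    have hi : i < width w := hi
    simp [hG, hi, hj]
  · rintro ⟨n, G, rfl, h⟩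
    rw [width_encodeGraph]
    exact graphMat_of_graph G (isMat_encodeGraph G)
      (fun i j => (entry_encodeGraph G i j).symm) h

theorem exists_encodeGraph_iff_graphMat {w : List Letter} {Φ : ∀ n, SimpleGraph (Fin n) → Prop}
    {Ψ : List Letter → Prop} (h : ∀ n G, Φ n G ↔ Ψ (encodeGraph G)) :
    (∃ (n : ℕ) (G : SimpleGraph (Fin n)), w = encodeGraph G ∧ NoIsolated G ∧ Φ n G) ↔
      GraphMat w (width w) 0 ∧ Ψ w := by
  rw [graphMat_iff]
  constructor
  · rintro ⟨n, G, rfl, h1, h2⟩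
    exact ⟨⟨n, G, rfl, h1⟩, (h n G).1 h2⟩
  · rintro ⟨⟨n, G, rfl, h1⟩, h2⟩
    exact ⟨n, G, rfl, h1, (h n G).2 h2⟩

theorem hasTri_fin_iff {n m k : ℕ} {J : Fin n → Fin m → Prop} {J' : ℕ → ℕ → Prop}
    (h : ∀ i j, J i j ↔ J' i j) (hJ' : ∀ i j, J' i j → i < n ∧ j < m) :
    HasTri J k ↔ HasTri J' k :=
  hasTri_iff_of_rel (fun i i' => i.1 = i') (fun j j' => j.1 = j')
    (fun i j _ => ⟨⟨i, rfl⟩, ⟨j, rfl⟩⟩)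
    (fun i j hij => ⟨⟨⟨i, (hJ' i j hij).1⟩, rfl⟩, ⟨⟨j, (hJ' i j hij).2⟩, rfl⟩⟩)
    (by rintro i _ j _ rfl rfl; exact h i j)

/-- As for the other four problems, membership splits into a validity test and a triangular sequence
for a relation on `ℕ`. Test and relation use only bounded quantifiers over letters of the word, so
that both can be written as expressions. -/
theorem mem_grundyDomination_iff (w : List Letter) (k : ℕ) :
    (w, k) ∈ GrundyDomination ↔ GraphMat w (width w) 0 ∧
      HasTri (fun i j => i < width w ∧ j < width w ∧ (j = i ∨ Entry w (width w) i j)) k := by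
  refine exists_encodeGraph_iff_graphMat (Φ := fun n G => ∃ m ≥ k, ∃ s : Fin m → Fin n,
    IsDominatingSeq G s) (Ψ := fun w => HasTri (fun i j => i < width w ∧ j < width w ∧
      (j = i ∨ Entry w (width w) i j)) k) fun n G => ?_
  rw [width_encodeGraph]
  refine exists_isFootprintSeq_iff.trans (hasTri_fin_iff (fun i j => ?_) (fun i j h => ?_))
  · simp [closedNbhd, entry_encodeGraph, Fin.ext_iff]
  · exact ⟨h.1, h.2.1⟩

theorem mem_totalGrundyDomination_iff (w : List Letter) (k : ℕ) :
    (w, k) ∈ TotalGrundyDomination ↔ GraphMat w (width w) 0 ∧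
      HasTri (fun i j => i < width w ∧ j < width w ∧ Entry w (width w) i j) k := by
  refine exists_encodeGraph_iff_graphMat (Φ := fun n G => ∃ m ≥ k, ∃ s : Fin m → Fin n,
    IsTotalDominatingSeq G s) (Ψ := fun w => HasTri (fun i j => i < width w ∧ j < width w ∧
      Entry w (width w) i j) k) fun n G => ?_
  rw [width_encodeGraph]
  refine exists_isFootprintSeq_iff.trans (hasTri_fin_iff (fun i j => ?_) (fun i j h => ?_))
  · simp [entry_encodeGraph]
  · exact ⟨h.1, h.2.1⟩

/-- The two copies of the vertex set occupy the columns below the width and the next `width w`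
columns. -/
theorem mem_lGrundyDomination_iff (w : List Letter) (k : ℕ) :
    (w, k) ∈ LGrundyDomination ↔ GraphMat w (width w) 0 ∧
      HasTri (fun i j => i < width w ∧ ((j < width w ∧ Entry w (width w) i j) ∨
        (width w ≤ j ∧ j < width w + width w ∧
          (j - width w = i ∨ Entry w (width w) i (j - width w))))) k := by
  refine exists_encodeGraph_iff_graphMat (Φ := fun n G => ∃ m ≥ k, ∃ s : Fin m → Fin n,
    IsLSeq G s) (Ψ := fun w => HasTri (fun i j => i < width w ∧
      ((j < width w ∧ Entry w (width w) i j) ∨ (width w ≤ j ∧ j < width w + width w ∧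
        (j - width w = i ∨ Entry w (width w) i (j - width w))))) k) fun n G => ?_
  rw [width_encodeGraph]
  refine exists_isLSeq_iff.trans (hasTri_iff_of_rel (fun i i' => i.1 = i')
    (fun y j => y.elim (fun x => x.1 = j) (fun x => n + x.1 = j)) (fun i y _ => ⟨⟨_, rfl⟩, ?_⟩)
    (fun i j h => ⟨⟨⟨i, h.1⟩, rfl⟩, ?_⟩) ?_)
  · rcases y with y | y
    · exact ⟨_, rfl⟩
    · exact ⟨_, rfl⟩
  · rcases h.2 with h | h
    · exact ⟨Sum.inl ⟨j, h.1⟩, rfl⟩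
    · exact ⟨Sum.inr ⟨j - n, by omega⟩, Nat.add_sub_cancel' h.1⟩
  · rintro i _ (y | y) _ rfl rfl
    · have : ¬ n ≤ y.1 := by omega
      simp [lIncidence, entry_encodeGraph, this]
    · have : ¬ n + y.1 < n := by omega
      simp [lIncidence, entry_encodeGraph, Fin.ext_iff]

/-- The word encodes a bipartite graph without isolated vertices. -/
def BipMat (w : List Letter) (c : ℕ) : Prop :=
  GraphMat w c 1 ∧ ∀ i < c, ∀ j < c, Entry w c (i + 1) j → (Entry w c 0 i ↔ ¬ Entry w c 0 j)

theorem isMat_encodeGraphWithSet {n : ℕ} (G : SimpleGraph (Fin n)) (A : Set (Fin n)) :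
    IsMat (encodeGraphWithSet G A) (n + 1) n := by
  rw [encodeGraphWithSet_eq]; exact isMat_matWord ..

theorem width_encodeGraphWithSet {n : ℕ} (G : SimpleGraph (Fin n)) (A : Set (Fin n)) :
    width (encodeGraphWithSet G A) = n :=
  (isMat_encodeGraphWithSet G A).width_eq n.succ_pos

theorem entry_encodeGraphWithSet {n : ℕ} (G : SimpleGraph (Fin n)) (A : Set (Fin n))
    (i j : Fin n) : Entry (encodeGraphWithSet G A) n (i + 1) j ↔ G.Adj i j := by
  rw [encodeGraphWithSet_eq, entry_matWord (by omega) j.2]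
  simp

theorem entry_zero_encodeGraphWithSet {n : ℕ} (G : SimpleGraph (Fin n)) (A : Set (Fin n))
    (j : Fin n) : Entry (encodeGraphWithSet G A) n 0 j ↔ j ∈ A := by
  rw [encodeGraphWithSet_eq, entry_matWord (by omega) j.2]
  simp

theorem bipMat_iff {w : List Letter} : BipMat w (width w) ↔
    ∃ (n : ℕ) (G : SimpleGraph (Fin n)) (A : Set (Fin n)), w = encodeGraphWithSet G A ∧
      G.IsBipartiteWith A Aᶜ ∧ NoIsolated G := by
  constructor
  · rintro ⟨h, h'⟩
    obtain ⟨G, hG, hn⟩ := h.exists_graph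
    refine ⟨_, G, {i | Entry w (width w) 0 i}, ?_, ⟨disjoint_compl_right, fun i j hij => ?_⟩, hn⟩
    · rw [encodeGraphWithSet_eq]
      nth_rw 1 [IsMat.eq_matWord h.1]
      refine matWord_congr fun i hi j hj => ?_
      rcases i with _ | i
      · simp [hj]
      · have hi : i < width w := by omega
        simp [hG, hi, hj]
    · have := h' i i.2 j j.2 ((hG i j).1 hij)
      simp only [Set.mem_ofPred_eq, Set.mem_compl_iff]
      tauto
  · rintro ⟨n, G, A, rfl, hA, h⟩
    rw [width_encodeGraphWithSet]
    refine ⟨graphMat_of_graph G (isMat_encodeGraphWithSet G A)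
      (fun i j => (entry_encodeGraphWithSet G A i j).symm) h, fun i hi j hj hij => ?_⟩
    have h1 := hA.mem_of_adj ((entry_encodeGraphWithSet G A ⟨i, hi⟩ ⟨j, hj⟩).1 hij)
    rw [entry_zero_encodeGraphWithSet G A ⟨i, hi⟩, entry_zero_encodeGraphWithSet G A ⟨j, hj⟩]
    simp only [Set.mem_compl_iff] at h1
    tauto

theorem exists_isTotalDominatingSeq_mem_iff {V : Type} {G : SimpleGraph V} {A : Set V} {k : ℕ} :
    (∃ s : Fin k → V, IsTotalDominatingSeq G s ∧ ∀ i, s i ∈ A) ↔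
      HasTri (fun v u => v ∈ A ∧ G.Adj v u) k := by
  simp only [IsTotalDominatingSeq, isFootprintSeq_self_iff]
  constructor
  · rintro ⟨s, ⟨u, hu⟩, hA⟩
    exact ⟨s, u, fun i => ⟨⟨hA i, (hu i).1⟩, fun j hj hJ => (hu i).2 j hj hJ.2⟩⟩
  · rintro ⟨s, u, hu⟩
    exact ⟨s, ⟨u, fun i => ⟨(hu i).1.2, fun j hj hJ => (hu i).2 j hj ⟨(hu j).1.1, hJ⟩⟩⟩,
      fun i => (hu i).1.1⟩

theorem exists_isTotalDominatingSeq_mem_iff_entry {n : ℕ} (G : SimpleGraph (Fin n))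
    (A : Set (Fin n)) (k : ℕ) :
    (∃ s : Fin k → Fin n, IsTotalDominatingSeq G s ∧ ∀ i, s i ∈ A) ↔
      HasTri (fun i j => i < n ∧ j < n ∧ Entry (encodeGraphWithSet G A) n 0 i ∧
        Entry (encodeGraphWithSet G A) n (i + 1) j) k := by
  refine exists_isTotalDominatingSeq_mem_iff.trans
    (hasTri_fin_iff (fun i j => ?_) (fun i j h => ?_))
  · simp [entry_encodeGraphWithSet, entry_zero_encodeGraphWithSet]
  · exact ⟨h.1, h.2.1⟩

theorem mem_oneSided_iff (w : List Letter) (k : ℕ) :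
    (w, k) ∈ OneSidedGrundyTotalDomination ↔ BipMat w (width w) ∧
      HasTri (fun i j => i < width w ∧ j < width w ∧ Entry w (width w) 0 i ∧
        Entry w (width w) (i + 1) j) k := by
  rw [bipMat_iff]
  constructor
  · rintro ⟨n, G, A, hw, h1, h2, h3⟩
    obtain rfl : w = _ := hw
    refine ⟨⟨n, G, A, rfl, h1, h2⟩, ?_⟩
    rw [width_encodeGraphWithSet]
    exact (exists_isTotalDominatingSeq_mem_iff_entry G A k).1 h3
  · rintro ⟨⟨n, G, A, rfl, h1, h2⟩, h3⟩
    rw [width_encodeGraphWithSet] at h3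
    exact ⟨n, G, A, rfl, h1, h2, (exists_isTotalDominatingSeq_mem_iff_entry G A k).2 h3⟩

/-- The word encodes a hypergraph. -/
def HyperMat (w : List Letter) (c : ℕ) : Prop :=
  ∃ r, 0 < r ∧ IsMat w r c ∧ ∀ j < c, Entry w c 0 j

theorem isMat_encodeHypergraph (n : ℕ) (l : List (Set (Fin n))) :
    IsMat (encodeHypergraph n l) (l.length + 1) n := by
  rw [encodeHypergraph_eq]; exact isMat_matWord ..

theorem width_encodeHypergraph (n : ℕ) (l : List (Set (Fin n))) :
    width (encodeHypergraph n l) = n :=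
  (isMat_encodeHypergraph n l).width_eq (Nat.succ_pos _)

theorem entry_encodeHypergraph {n : ℕ} (l : List (Set (Fin n))) (i : ℕ) (j : Fin n) :
    Entry (encodeHypergraph n l) n (i + 1) j ↔ ∃ e, l[i]? = some e ∧ j ∈ e := by
  by_cases hi : i < l.length
  · rw [encodeHypergraph_eq, entry_matWord (by omega) j.2]
    simp
  · have : l[i]? = none := List.getElem?_eq_none (by omega)
    simp only [this, Entry]
    rw [List.getElem?_eq_none]
    · simp
    · rw [(isMat_encodeHypergraph n l).1]
      calc (l.length + 1) * (n + 1) ≤ (i + 1) * (n + 1) := by gcongr; omega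
        _ ≤ _ := Nat.le_add_right _ _

theorem hyperMat_iff {w : List Letter} : HyperMat w (width w) ↔
    ∃ (n : ℕ) (l : List (Set (Fin n))), w = encodeHypergraph n l := by
  constructor
  · rintro ⟨r, hr, h, h0⟩
    obtain ⟨r, rfl⟩ := Nat.exists_eq_succ_of_ne_zero hr.ne'
    refine ⟨width w, (List.range r).map fun i => {j | Entry w (width w) (i + 1) j}, ?_⟩
    rw [encodeHypergraph_eq]
    nth_rw 1 [IsMat.eq_matWord h]
    simp only [List.length_map, List.length_range]
    refine matWord_congr fun i hi j hj => ?_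
    rcases i with _ | i
    · simp [h0 j hj]
    · have hi : i < r := by omega
      simp [hi, hj]
  · rintro ⟨n, l, rfl⟩
    rw [width_encodeHypergraph]
    refine ⟨l.length + 1, Nat.succ_pos _, isMat_encodeHypergraph n l, fun j hj => ?_⟩
    rw [encodeHypergraph_eq, entry_matWord (Nat.succ_pos _) hj]
    exact Or.inl rfl

theorem exists_isCoveringSeq_iff {X : Type} {H : Hypergraph X} {k : ℕ} :
    (∃ m ≥ k, ∃ C : Fin m → Set X, IsCoveringSeq H C) ↔
      HasTri (fun e x => e ∈ H.edgeSet ∧ x ∈ e) k := by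
  have key : ∀ m, (∃ C : Fin m → Set X, IsCoveringSeq H C) ↔
      HasTri (fun e x => e ∈ H.edgeSet ∧ x ∈ e) m := fun m => by
    simp only [IsCoveringSeq, Set.Nonempty, Set.mem_sdiff, Set.mem_iUnion, not_exists]
    constructor
    · rintro ⟨C, h1, h2⟩
      choose x hx using h2
      exact ⟨C, x, fun i => ⟨⟨h1 i, (hx i).1⟩, fun j hj hJ => (hx i).2 j hj hJ.2⟩⟩
    · rintro ⟨C, x, h⟩
      exact ⟨C, fun i => (h i).1.1, fun i => ⟨x i, (h i).1.2, fun j hj hJ =>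
        (h i).2 j hj ⟨(h j).1.1, hJ⟩⟩⟩
  simp only [key]
  exact ⟨fun ⟨m, hm, h⟩ => h.mono hm, fun h => ⟨k, le_rfl, h⟩⟩

/-- The length of the word is a crude bound for the number of edges that needs no division; rows
beyond the end of the word have no entries. An edge listed several times corresponds to several
equal rows, which is harmless. -/
theorem mem_grundyCovering_iff (w : List Letter) (k : ℕ) :
    (w, k) ∈ GrundyCovering ↔ HyperMat w (width w) ∧
      HasTri (fun i j => i < w.length ∧ j < width w ∧ Entry w (width w) (i + 1) j) k := by
  have key : ∀ n (l : List (Set (Fin n))), HasTri (fun e x => e ∈ {e | e ∈ l} ∧ x ∈ e) k ↔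
      HasTri (fun i j => i < (encodeHypergraph n l).length ∧ j < n ∧
        Entry (encodeHypergraph n l) n (i + 1) j) k := fun n l => by
    refine hasTri_iff_of_rel (fun e i => l[i]? = some e) (fun x j => x.1 = j)
      (fun e x h => ⟨List.mem_iff_getElem?.1 h.1, ⟨_, rfl⟩⟩) (fun i j h => ?_) ?_
    · obtain ⟨e, he, -⟩ := (entry_encodeHypergraph l i ⟨j, h.2.1⟩).1 h.2.2
      exact ⟨⟨e, he⟩, ⟨⟨j, h.2.1⟩, rfl⟩⟩
    · rintro e i x _ he rfl
      have hi : i < (encodeHypergraph n l).length := by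
        have : i < l.length := (List.getElem?_eq_some_iff.1 he).1
        rw [(isMat_encodeHypergraph n l).1]
        nlinarith
      simp [entry_encodeHypergraph, he, hi, List.mem_of_getElem? he]
  rw [hyperMat_iff]
  constructor
  · rintro ⟨n, H, l, hv, he, hw, h⟩
    obtain rfl : w = _ := hw
    rw [exists_isCoveringSeq_iff, he] at h
    rw [width_encodeHypergraph]
    exact ⟨⟨n, l, rfl⟩, (key n l).1 h⟩
  · rintro ⟨⟨n, l, rfl⟩, h⟩
    rw [width_encodeHypergraph] at h
    refine ⟨n, ⟨Set.univ, {e | e ∈ l}, fun _ _ => Set.subset_univ _⟩, l, rfl, rfl, rfl,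
      exists_isCoveringSeq_iff.2 ((key n l).2 h)⟩

/-! ### Instances of the five problems made from an incidence relation -/

/-- The adjacency of the graph on the vertices `0, …, M + N + 3` in which the first `M + 2`
vertices and the last `N + 2` vertices are cliques, and `J` gives the other edges. -/
def cobAdj (M : ℕ) (J : ℕ → ℕ → Prop) (a b : ℕ) : Prop :=
  a ≠ b ∧ ((a < M + 2 ↔ b < M + 2) ∨ (a < M + 2 ∧ M + 2 ≤ b ∧ J a (b - (M + 2))) ∨
    (b < M + 2 ∧ M + 2 ≤ a ∧ J b (a - (M + 2))))

theorem cobAdj_symm {M : ℕ} {J : ℕ → ℕ → Prop} {a b : ℕ} (h : cobAdj M J a b) :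
    cobAdj M J b a := by
  unfold cobAdj at *
  tauto

/-- The graph with the adjacency `cobAdj`. -/
def cobGraph (M N : ℕ) (J : ℕ → ℕ → Prop) : SimpleGraph (Fin (M + 2 + (N + 2))) where
  Adj a b := cobAdj M J a b
  symm := ⟨fun _ _ h => cobAdj_symm h⟩
  loopless := ⟨fun _ h => h.1 rfl⟩

/-- The adjacency of the bipartite double cover of a graph on `0, …, n - 1`. -/
def coverAdj (n : ℕ) (R : ℕ → ℕ → Prop) (a b : ℕ) : Prop :=
  (a < n ∧ n ≤ b ∧ R a (b - n)) ∨ (b < n ∧ n ≤ a ∧ R b (a - n))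

/-- The bipartite double cover. -/
def coverGraph {n : ℕ} (R : ℕ → ℕ → Prop) : SimpleGraph (Fin (n + n)) where
  Adj a b := coverAdj n R a b
  symm := ⟨fun _ _ h => Or.symm h⟩
  loopless := ⟨fun _ h => by unfold coverAdj at h; omega⟩

section

variable {M N k : ℕ} {J : ℕ → ℕ → Prop}

/-- Row `M`, row `M + 1` and the last two columns lie outside the range of `J`, so they provide the
vertices without neighbors on the other side. -/
theorem isCobip_cobGraph (hJ : ∀ i j, J i j → i < M ∧ j < N) :
    IsCobip (cobGraph M N J) (fun v => v.1 < M + 2) where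
  adj u v huv h := ⟨fun h => huv (Fin.ext h), Or.inl h⟩
  exists_left := by
    refine ⟨⟨M, by omega⟩, ⟨M + 1, by omega⟩, by simp, by simp, by simp, fun x hx => ?_⟩
    constructor
    all_goals
      rintro ⟨-, h | h | h⟩
      · simp at h; omega
      · have := hJ _ _ h.2.2
        simp at this
      · exact hx h.1
  exists_right := by
    refine ⟨⟨M + 2 + N, by omega⟩, ⟨M + 2 + (N + 1), by omega⟩, by simp, by simp, by simp,
      fun x hx => ?_⟩
    constructor
    all_goals
      rintro ⟨-, h | h | h⟩
      · simp at h; omega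
      · simp at h
      · have := hJ _ _ h.2.2
        simp at this

theorem hasTri_crossAdj_cobGraph (hJ : ∀ i j, J i j → i < M ∧ j < N) :
    HasTri (crossAdj (cobGraph M N J) fun v => v.1 < M + 2) k ↔ HasTri J k := by
  refine hasTri_iff_of_rel (fun v i => v.1 = i) (fun u j => u.1 = M + 2 + j)
    (fun v u h => ⟨⟨_, rfl⟩, ⟨u - (M + 2), ?_⟩⟩) (fun i j h => ?_) ?_
  · have := h.2.1
    omega
  · have := hJ i j h
    exact ⟨⟨⟨i, by omega⟩, rfl⟩, ⟨⟨M + 2 + j, by omega⟩, rfl⟩⟩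
  · rintro v _ u j rfl hu
    have h1 : ¬ u.1 < M + 2 := by omega
    have h2 : M + 2 ≤ u.1 := by omega
    have h3 : u.1 - (M + 2) = j := by omega
    simp only [crossAdj, cobGraph, cobAdj, h1, h2, h3]
    constructor
    · tauto
    · intro h
      have := hJ _ _ h
      refine ⟨by omega, by simp, by omega, Or.inr (Or.inl ⟨by omega, trivial, h⟩)⟩

theorem matWord_cobAdj : matWord (M + 2 + (N + 2)) (M + 2 + (N + 2)) (cobAdj M J) =
    encodeGraph (cobGraph M N J) := by
  rw [encodeGraph_eq]
  exact matWord_congr fun i hi j hj => by simp [cobGraph, hi, hj]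

theorem cob_mem_grundyDomination_iff (hJ : ∀ i j, J i j → i < M ∧ j < N) :
    (matWord (M + 2 + (N + 2)) (M + 2 + (N + 2)) (cobAdj M J), k + 2) ∈ GrundyDomination ↔
      HasTri J k := by
  have h := isCobip_cobGraph hJ
  rw [matWord_cobAdj, ← hasTri_crossAdj_cobGraph hJ, ← h.exists_isDominatingSeq_iff]
  refine (exists_encodeGraph_iff (Φ := fun n G => NoIsolated G ∧ ∃ m ≥ k + 2,
    ∃ s : Fin m → Fin n, IsDominatingSeq G s)).trans ⟨fun h => h.2, fun h' => ⟨h.noIsolated, h'⟩⟩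

theorem cob_mem_totalGrundyDomination_iff (hJ : ∀ i j, J i j → i < M ∧ j < N) :
    (matWord (M + 2 + (N + 2)) (M + 2 + (N + 2)) (cobAdj M J), k + 4) ∈ TotalGrundyDomination ↔
      HasTri J k := by
  have h := isCobip_cobGraph hJ
  rw [matWord_cobAdj, ← hasTri_crossAdj_cobGraph hJ, ← h.exists_isTotalDominatingSeq_iff]
  refine (exists_encodeGraph_iff (Φ := fun n G => NoIsolated G ∧ ∃ m ≥ k + 4,
    ∃ s : Fin m → Fin n, IsTotalDominatingSeq G s)).trans
    ⟨fun h => h.2, fun h' => ⟨h.noIsolated, h'⟩⟩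

theorem cob_mem_lGrundyDomination_iff (hJ : ∀ i j, J i j → i < M ∧ j < N) :
    (matWord (M + 2 + (N + 2)) (M + 2 + (N + 2)) (cobAdj M J), k + 4) ∈ LGrundyDomination ↔
      HasTri J k := by
  have h := isCobip_cobGraph hJ
  rw [matWord_cobAdj, ← hasTri_crossAdj_cobGraph hJ, ← h.exists_isLSeq_iff]
  refine (exists_encodeGraph_iff (Φ := fun n G => NoIsolated G ∧ ∃ m ≥ k + 4,
    ∃ s : Fin m → Fin n, IsLSeq G s)).trans ⟨fun h => h.2, fun h' => ⟨h.noIsolated, h'⟩⟩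

theorem matWord_coverAdj {n : ℕ} {R : ℕ → ℕ → Prop} :
    matWord (n + n + 1) (n + n)
      (fun i j => (i = 0 ∧ j < n) ∨ (i ≠ 0 ∧ coverAdj n R (i - 1) j)) =
    encodeGraphWithSet (coverGraph (n := n) R) {v | v.1 < n} := by
  rw [encodeGraphWithSet_eq]
  refine matWord_congr fun i hi j hj => ?_
  rcases i with _ | i
  · simp [hj]
  · have hi : i < n + n := by omega
    simp [coverGraph, hi, hj]

theorem isBipartiteWith_coverGraph {n : ℕ} {R : ℕ → ℕ → Prop} :
    (coverGraph (n := n) R).IsBipartiteWith {v | v.1 < n} {v | v.1 < n}ᶜ := by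
  refine ⟨disjoint_compl_right, fun a b h => ?_⟩
  simp only [coverGraph, coverAdj] at h
  simp only [Set.mem_ofPred_eq, Set.mem_compl_iff]
  omega

theorem noIsolated_coverGraph {n : ℕ} {R : ℕ → ℕ → Prop} {G : SimpleGraph (Fin n)}
    (hG : ∀ a b, G.Adj a b ↔ R a b) (h : NoIsolated G) : NoIsolated (coverGraph (n := n) R) := by
  have h' : ∀ v : Fin n, ∃ u : Fin n, R v.1 u.1 := fun v => by
    by_contra hv
    exact h v fun u hu => hv ⟨u, (hG v u).1 hu⟩
  intro v hv
  by_cases hvn : v.1 < n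
  · obtain ⟨u, hu⟩ := h' ⟨v, hvn⟩
    exact hv ⟨n + u, by omega⟩ (Or.inl ⟨hvn, Nat.le_add_right _ _, by simpa using hu⟩)
  · obtain ⟨u, hu⟩ := h' ⟨v - n, by omega⟩
    have : R u.1 (v.1 - n) := (hG u ⟨v - n, by omega⟩).1 ((hG ⟨v - n, by omega⟩ u).2 hu).symm
    exact hv ⟨u, by omega⟩ (Or.inr ⟨u.2, not_lt.1 hvn, this⟩)

/-- Chosen vertices live in the first copy and their footprints in the second, so the double cover
separates the two roles of a vertex. -/
theorem hasTri_coverGraph {n : ℕ} {R : ℕ → ℕ → Prop} {G : SimpleGraph (Fin n)}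
    (hG : ∀ a b, G.Adj a b ↔ R a b) :
    HasTri (fun v u => v ∈ {v : Fin (n + n) | v.1 < n} ∧ (coverGraph (n := n) R).Adj v u) k ↔
      HasTri G.Adj k := by
  refine hasTri_iff_of_rel (fun v i => v.1 = i.1) (fun u j => u.1 = n + j.1)
    (fun v u h => ?_) (fun i j h => ⟨⟨⟨i, by omega⟩, rfl⟩, ⟨⟨n + j, by omega⟩, rfl⟩⟩) ?_
  · have h1 : v.1 < n := h.1
    have h2 : n ≤ u.1 := by
      have := h.2
      simp only [coverGraph, coverAdj] at this
      omega
    exact ⟨⟨⟨v, h1⟩, rfl⟩, ⟨⟨u - n, by omega⟩, by simp; omega⟩⟩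
  · intro v i u j hv hu
    have h1 : v.1 < n := by omega
    have h2 : n ≤ u.1 := by omega
    have h3 : u.1 - n = j := by omega
    have h4 : ¬ u.1 < n := by omega
    simp [hG, coverGraph, coverAdj, h2, h3, h4, hv]

theorem cover_mem_oneSided_iff (hJ : ∀ i j, J i j → i < M ∧ j < N) {n : ℕ}
    (hn : n = M + 2 + (N + 2)) :
    (matWord (n + n + 1) (n + n)
      (fun i j => (i = 0 ∧ j < n) ∨ (i ≠ 0 ∧ coverAdj n (cobAdj M J) (i - 1) j)), k + 4) ∈
        OneSidedGrundyTotalDomination ↔ HasTri J k := by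
  subst hn
  have h := isCobip_cobGraph hJ
  have hG : ∀ a b, (cobGraph M N J).Adj a b ↔ cobAdj M J a b := fun a b => Iff.rfl
  rw [matWord_coverAdj, mem_oneSided_iff, width_encodeGraphWithSet,
    ← exists_isTotalDominatingSeq_mem_iff_entry, exists_isTotalDominatingSeq_mem_iff,
    hasTri_coverGraph hG, h.hasTri_adj_iff, hasTri_crossAdj_cobGraph hJ, and_iff_right]
  have := bipMat_iff.2 ⟨_, coverGraph _, _, rfl, isBipartiteWith_coverGraph,
    noIsolated_coverGraph hG h.noIsolated⟩
  rwa [width_encodeGraphWithSet] at this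

theorem mat_mem_grundyCovering_iff (hJ : ∀ i j, J i j → i < M ∧ j < N) :
    (matWord (M + 1) N (fun i j => i = 0 ∨ J (i - 1) j), k) ∈ GrundyCovering ↔ HasTri J k := by
  have h := isMat_matWord (M + 1) N (fun i j => i = 0 ∨ J (i - 1) j)
  rw [mem_grundyCovering_iff, h.width_eq (Nat.succ_pos _), and_iff_right
    ⟨M + 1, Nat.succ_pos _, h, fun j hj => (entry_matWord (Nat.succ_pos _) hj).2 (Or.inl rfl)⟩]
  refine hasTri_congr fun i j => ⟨fun hij => ?_, fun hij => ?_⟩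
  · by_cases hi : i < M
    · simpa using (entry_matWord (by omega) hij.2.1).1 hij.2.2
    -- Row `i + 1` with `i ≥ M` lies beyond the end of the word.
    · have h0 := hij.2.2
      rw [Entry, List.getElem?_eq_none] at h0
      · simp at h0
      · rw [h.1]
        calc (M + 1) * (N + 1) ≤ (i + 1) * (N + 1) := by gcongr; omega
          _ ≤ _ := Nat.le_add_right _ _
  · have hlt := hJ i j hij
    refine ⟨?_, hlt.2, (entry_matWord (by omega) hlt.2).2 (Or.inr hij)⟩
    rw [h.1]
    nlinarith

end

/-! ### Conditions on words as expressions. -/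

namespace Expr

variable {w : List Letter} {env : ℕ → ℕ} {a b e n : Expr} {x : ℕ}

/-- An expression is used as a condition that holds if its value is not zero. -/
def Holds (w : List Letter) (env : ℕ → ℕ) (e : Expr) : Prop := e.eval w env ≠ 0

/-- Truncated subtraction provides the logic: `1 - e` vanishes exactly if `e` does not, and `b - a`
is nonzero exactly if `a < b`. Products are conjunctions, sums are disjunctions or bounded
existential quantifiers. -/
def not (e : Expr) : Expr := sub (const 1) e

def lt (a b : Expr) : Expr := sub b a

def le (a b : Expr) : Expr := not (sub a b)

def eq (a b : Expr) : Expr := mul (le a b) (le b a)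

def all (x : ℕ) (n b : Expr) : Expr := not (sum x n (not b))

@[simp] theorem eval_const {c : ℕ} : (const c).eval w env = c := rfl
@[simp] theorem eval_var : (var x).eval w env = env x := rfl
@[simp] theorem eval_len : len.eval w env = w.length := rfl
@[simp] theorem eval_add : (add a b).eval w env = a.eval w env + b.eval w env := rfl
@[simp] theorem eval_mul : (mul a b).eval w env = a.eval w env * b.eval w env := rfl
@[simp] theorem eval_sub : (sub a b).eval w env = a.eval w env - b.eval w env := rfl

theorem eval_sum : (sum x n b).eval w env =
    ∑ i ∈ Finset.range (n.eval w env), b.eval w (update env x i) := rfl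

@[simp] theorem holds_not : Holds w env (not e) ↔ ¬ Holds w env e := by
  simp [Holds, not]; omega

@[simp] theorem holds_mul : Holds w env (mul a b) ↔ Holds w env a ∧ Holds w env b := by
  simp [Holds]

@[simp] theorem holds_add : Holds w env (add a b) ↔ Holds w env a ∨ Holds w env b := by
  simp [Holds]; tauto

@[simp] theorem holds_lt : Holds w env (lt a b) ↔ a.eval w env < b.eval w env := by
  simp [Holds, lt]; omega

@[simp] theorem holds_le : Holds w env (le a b) ↔ a.eval w env ≤ b.eval w env := by
  simp [Holds, le, not]; omega

@[simp] theorem holds_eq : Holds w env (eq a b) ↔ a.eval w env = b.eval w env := by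
  simp only [eq, holds_mul, holds_le]; omega

@[simp] theorem holds_sum : Holds w env (sum x n b) ↔
    ∃ i < n.eval w env, Holds w (update env x i) b := by
  simp [Holds, eval_sum]

@[simp] theorem holds_all : Holds w env (all x n b) ↔
    ∀ i < n.eval w env, Holds w (update env x i) b := by
  simp [all]

@[simp] theorem holds_read {l : Letter} :
    Holds w env (read l e) ↔ w[e.eval w env]? = some l := by
  simp only [Holds, eval]
  split_ifs <;> simp_all

/-- Double negation normalizes the value of a condition to `0` or `1`, so that it can be a factor in
an arithmetic sum, as in `width`. -/
theorem eval_not_not [Decidable (Holds w env e)] :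
    (not (not e)).eval w env = if Holds w env e then 1 else 0 := by
  split_ifs with h
  all_goals
    simp only [Holds] at h
    simp only [not, eval_sub, eval_const]
    omega

/-- The width of a matrix. -/
def width : Expr :=
  sum 10 len (mul (not (not (mul (read .sep (var 10))
    (all 11 (var 10) (not (read .sep (var 11))))))) (var 10))

@[simp] theorem eval_width : width.eval w env = GrundyFPT.width w := by
  classical
  simp only [width, eval_sum, GrundyFPT.width, eval_mul, eval_not_not]
  refine Finset.sum_congr rfl fun i _ => ?_
  simp

/-- The entry of the matrix at the position `(a, b)`. -/
def entry (a b : Expr) : Expr := read .one (add (mul a (add width (const 1))) b)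

@[simp] theorem holds_entry : Holds w env (entry a b) ↔
    Entry w (GrundyFPT.width w) (a.eval w env) (b.eval w env) := by
  simp [entry, Entry]

/-- The word is a matrix with `r` rows. -/
def isMat (r : Expr) : Expr :=
  mul (eq len (mul r (add width (const 1)))) (all 12 r
    (mul (read .sep (add (mul (var 12) (add width (const 1))) width)) (all 13 width
      (add (read .one (add (mul (var 12) (add width (const 1))) (var 13)))
        (read .zero (add (mul (var 12) (add width (const 1))) (var 13)))))))

@[simp] theorem holds_isMat {r : Expr} : Holds w env (isMat r) ↔
    IsMat w (r.eval w env) (GrundyFPT.width w) := by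
  simp [isMat, IsMat]

/-- The condition `GraphMat`. -/
def graphMat (o : ℕ) : Expr :=
  mul (isMat (add width (const o))) (all 12 width
    (mul (not (entry (add (var 12) (const o)) (var 12)))
      (mul (all 13 width (add (not (entry (add (var 12) (const o)) (var 13)))
          (entry (add (var 13) (const o)) (var 12))))
        (sum 13 width (entry (add (var 12) (const o)) (var 13))))))

@[simp] theorem holds_graphMat {o : ℕ} : Holds w env (graphMat o) ↔
    GraphMat w (GrundyFPT.width w) o := by
  simp [graphMat, GraphMat, imp_iff_not_or]

/-- The condition `BipMat`. -/
def bipMat : Expr :=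
  mul (graphMat 1) (all 12 width (all 13 width
    (add (not (entry (add (var 12) (const 1)) (var 13)))
      (mul (add (entry (const 0) (var 12)) (entry (const 0) (var 13)))
        (add (not (entry (const 0) (var 12))) (not (entry (const 0) (var 13))))))))

@[simp] theorem holds_bipMat : Holds w env bipMat ↔ BipMat w (GrundyFPT.width w) := by
  simp only [bipMat, BipMat, holds_mul, holds_graphMat, holds_all, eval_width, holds_add,
    holds_not, holds_entry, eval_add, eval_var, eval_const, update_self]
  refine and_congr_right fun _ => forall₄_congr fun i _ j _ => ?_
  simp
  tauto

/-- The condition `HyperMat`. -/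
def hyperMat : Expr :=
  sum 14 (add len (const 1)) (mul (lt (const 0) (var 14)) (mul (isMat (var 14))
    (all 12 width (entry (const 0) (var 12)))))

@[simp] theorem holds_hyperMat : Holds w env hyperMat ↔ HyperMat w (GrundyFPT.width w) := by
  simp only [hyperMat, HyperMat, holds_sum, holds_mul, holds_lt, holds_isMat, holds_all,
    holds_entry, eval_width, eval_var, eval_const, update_self, eval_add, eval_len]
  refine exists_congr fun r => ⟨fun h => h.2, fun h => ⟨?_, h⟩⟩
  -- A matrix with `r` rows has at least `r` letters, so searching `r` up to the length of the word
  -- is enough.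
  rw [h.2.1.1]
  nlinarith

/-- The condition `cobAdj`. -/
def cobAdj (M : Expr) (J : Expr → Expr → Expr) (a b : Expr) : Expr :=
  let E : Expr := add M (const 2)
  mul (not (eq a b)) (add (add (mul (lt a E) (lt b E)) (mul (le E a) (le E b)))
    (add (mul (lt a E) (mul (le E b) (J a (sub b E)))) (mul (lt b E) (mul (le E a) (J b (sub a E))))))

theorem holds_cobAdj {M : Expr} {m : ℕ} {J : Expr → Expr → Expr} {R : ℕ → ℕ → Prop}
    (hM : M.eval w env = m)
    (hJ : ∀ a b, Holds w env (J a b) ↔ R (a.eval w env) (b.eval w env)) :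
    Holds w env (cobAdj M J a b) ↔ GrundyFPT.cobAdj m R (a.eval w env) (b.eval w env) := by
  simp only [cobAdj, GrundyFPT.cobAdj, holds_mul, holds_not, holds_eq, holds_add, holds_lt,
    holds_le, eval_add, eval_const, hJ, hM, eval_sub]
  refine and_congr_right fun _ => or_congr_left ?_
  omega

/-- The condition `coverAdj`. -/
def coverAdj (n : Expr) (R : Expr → Expr → Expr) (a b : Expr) : Expr :=
  add (mul (lt a n) (mul (le n b) (R a (sub b n)))) (mul (lt b n) (mul (le n a) (R b (sub a n))))

theorem holds_coverAdj {n' : ℕ} {R : Expr → Expr → Expr} {R' : ℕ → ℕ → Prop}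
    (hn : n.eval w env = n')
    (hR : ∀ a b, Holds w env (R a b) ↔ R' (a.eval w env) (b.eval w env)) :
    Holds w env (coverAdj n R a b) ↔
      GrundyFPT.coverAdj n' R' (a.eval w env) (b.eval w env) := by
  simp [coverAdj, GrundyFPT.coverAdj, hR, hn]

end Expr

open GrundyFPT.Expr

/-- The word expression for a matrix. -/
def Out.mat (r c e : Expr) : Out :=
  .iter 2 r (.append (.iter 3 c (.ite e (.emit .one) (.emit .zero))) (.emit .sep))

/-- The variables `2` and `3` hold the row and column index. The number of columns is evaluated
inside the row loop and so must not depend on the environment. -/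
theorem Out.eval_mat {w : List Letter} {env : ℕ → ℕ} {r c e : Expr} {r' c' : ℕ}
    {R : ℕ → ℕ → Prop} (hr : r.eval w env = r') (hc : ∀ env, c.eval w env = c')
    (he : ∀ env, Holds w env e ↔ R (env 2) (env 3)) :
    (Out.mat r c e).eval w env = matWord r' c' R := by
  simp only [Out.mat, Out.eval, hr, hc, matWord, rowWord]
  refine List.flatMap_congr fun i _ => ?_
  congr 1
  rw [List.map_eq_flatMap]
  refine List.flatMap_congr fun j _ => ?_
  have := he (update (update env 2 i) 3 j)
  simp only [Holds, update_self] at this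
  by_cases h : R i j <;> simp_all [bitLetter]

/-! ### The reductions -/

/-- A description of a parameterized problem by expressions for the validity of an instance and for
an incidence relation. -/
structure Source (P : ParamProblem Letter) where
  valid : Expr
  rows : Expr
  cols : Expr
  inc : Expr → Expr → Expr
  Valid : List Letter → Prop
  numRows : List Letter → ℕ
  numCols : List Letter → ℕ
  Inc : List Letter → ℕ → ℕ → Prop
  holds_valid : ∀ w env, Holds w env valid ↔ Valid w
  eval_rows : ∀ w env, rows.eval w env = numRows w
  eval_cols : ∀ w env, cols.eval w env = numCols w
  holds_inc : ∀ w env a b, Holds w env (inc a b) ↔ Inc w (a.eval w env) (b.eval w env)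
  inc_lt : ∀ w i j, Inc w i j → i < numRows w ∧ j < numCols w
  mem_iff : ∀ w k, (w, k) ∈ P ↔ Valid w ∧ HasTri (Inc w) k

theorem nonempty_source_grundyDomination : Nonempty (Source GrundyDomination) :=
  ⟨{ valid := graphMat 0
     rows := .width
     cols := .width
     inc := fun a b => mul (lt a .width) (mul (lt b .width) (add (eq b a) (entry a b)))
     Valid := _
     numRows := width
     numCols := width
     Inc := _
     holds_valid := fun _ _ => holds_graphMat
     eval_rows := fun _ _ => eval_width
     eval_cols := fun _ _ => eval_width
     holds_inc := fun w env a b => by simp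
     inc_lt := fun w i j h => ⟨h.1, h.2.1⟩
     mem_iff := mem_grundyDomination_iff }⟩

theorem nonempty_source_totalGrundyDomination : Nonempty (Source TotalGrundyDomination) :=
  ⟨{ valid := graphMat 0
     rows := .width
     cols := .width
     inc := fun a b => mul (lt a .width) (mul (lt b .width) (entry a b))
     Valid := _
     numRows := width
     numCols := width
     Inc := _
     holds_valid := fun _ _ => holds_graphMat
     eval_rows := fun _ _ => eval_width
     eval_cols := fun _ _ => eval_width
     holds_inc := fun w env a b => by simp
     inc_lt := fun w i j h => ⟨h.1, h.2.1⟩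
     mem_iff := mem_totalGrundyDomination_iff }⟩

theorem nonempty_source_lGrundyDomination : Nonempty (Source LGrundyDomination) :=
  ⟨{ valid := graphMat 0
     rows := .width
     cols := add .width .width
     inc := fun a b => mul (lt a .width) (add (mul (lt b .width) (entry a b))
      (mul (le .width b) (mul (lt b (add .width .width))
        (add (eq (sub b .width) a) (entry a (sub b .width))))))
     Valid := _
     numRows := width
     numCols := fun w => width w + width w
     Inc := _
     holds_valid := fun _ _ => holds_graphMat
     eval_rows := fun _ _ => eval_width
     eval_cols := fun _ _ => by simp
     holds_inc := fun w env a b => by simp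
     inc_lt := fun w i j h => ⟨h.1, by rcases h.2 with h | h <;> omega⟩
     mem_iff := mem_lGrundyDomination_iff }⟩

theorem nonempty_source_oneSided : Nonempty (Source OneSidedGrundyTotalDomination) :=
  ⟨{ valid := bipMat
     rows := .width
     cols := .width
     inc := fun a b => mul (lt a .width) (mul (lt b .width)
      (mul (entry (const 0) a) (entry (add a (const 1)) b)))
     Valid := _
     numRows := width
     numCols := width
     Inc := _
     holds_valid := fun _ _ => holds_bipMat
     eval_rows := fun _ _ => eval_width
     eval_cols := fun _ _ => eval_width
     holds_inc := fun w env a b => by simp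
     inc_lt := fun w i j h => ⟨h.1, h.2.1⟩
     mem_iff := mem_oneSided_iff }⟩

theorem nonempty_source_grundyCovering : Nonempty (Source GrundyCovering) :=
  ⟨{ valid := hyperMat
     rows := len
     cols := .width
     inc := fun a b => mul (lt a len) (mul (lt b .width) (entry (add a (const 1)) b))
     Valid := _
     numRows := List.length
     numCols := width
     Inc := _
     holds_valid := fun _ _ => holds_hyperMat
     eval_rows := fun _ _ => rfl
     eval_cols := fun _ _ => eval_width
     holds_inc := fun w env a b => by simp
     inc_lt := fun w i j h => ⟨h.1, h.2.1⟩
     mem_iff := mem_grundyCovering_iff }⟩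

/-- No instance of the five problems is encoded by the word `0`. -/
def ZeroNotMem (Q : ParamProblem Letter) : Prop := ∀ k, ([.zero], k) ∉ Q

/-- A reduction must be correct on all words, including those that encode nothing. The output
therefore branches on the validity test and sends invalid words to the fixed no-instance. -/
theorem Source.reducible {P Q : ParamProblem Letter} (S : Source P) (hQ : ZeroNotMem Q) (u : Out)
    (c : ℕ) (h : ∀ w k, S.Valid w →
      ((u.eval w (fun _ => 0), k + c) ∈ Q ↔ HasTri (S.Inc w) k)) : PolyTimeFPTReducible P Q := by
  refine polyTimeFPTReducible_of_out (.ite S.valid u (.emit .zero)) c fun ⟨w, k⟩ => ?_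
  rw [S.mem_iff]
  by_cases hv : S.Valid w
  · have : S.valid.eval w (fun _ => 0) ≠ 0 := (S.holds_valid w fun _ => 0).2 hv
    rw [Out.eval, if_pos this, h w k hv, and_iff_right hv]
  · have : ¬ S.valid.eval w (fun _ => 0) ≠ 0 := mt (S.holds_valid w fun _ => 0).1 hv
    rw [Out.eval, if_neg this]
    exact ⟨fun h => (hv h.1).elim, fun h => (hQ _ h).elim⟩

theorem zeroNotMem_grundyDomination : ZeroNotMem GrundyDomination := fun k h =>
  not_isMat_zero _ _ ((mem_grundyDomination_iff _ k).1 h).1.1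

theorem zeroNotMem_totalGrundyDomination : ZeroNotMem TotalGrundyDomination := fun k h =>
  not_isMat_zero _ _ ((mem_totalGrundyDomination_iff _ k).1 h).1.1

theorem zeroNotMem_lGrundyDomination : ZeroNotMem LGrundyDomination := fun k h =>
  not_isMat_zero _ _ ((mem_lGrundyDomination_iff _ k).1 h).1.1

theorem zeroNotMem_oneSided : ZeroNotMem OneSidedGrundyTotalDomination := fun k h =>
  not_isMat_zero _ _ ((mem_oneSided_iff _ k).1 h).1.1.1

theorem zeroNotMem_grundyCovering : ZeroNotMem GrundyCovering := fun k h =>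
  let ⟨_, _, h, _⟩ := ((mem_grundyCovering_iff _ k).1 h).1
  not_isMat_zero _ _ h

namespace Source

variable {P : ParamProblem Letter} (S : Source P)

/-- The number of vertices of the graph for the reductions to problems on graphs. -/
def order : Expr := add (add S.rows (const 2)) (add S.cols (const 2))

theorem eval_order (w : List Letter) (env : ℕ → ℕ) :
    S.order.eval w env = S.numRows w + 2 + (S.numCols w + 2) := by
  simp [order, S.eval_rows, S.eval_cols]

/-- The graph for the reductions to problems on graphs. -/
def cob : Out := .mat S.order S.order (Expr.cobAdj S.rows S.inc (var 2) (var 3))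

theorem eval_cob (w : List Letter) (env : ℕ → ℕ) : S.cob.eval w env =
    matWord (S.numRows w + 2 + (S.numCols w + 2)) (S.numRows w + 2 + (S.numCols w + 2))
      (GrundyFPT.cobAdj (S.numRows w) (S.Inc w)) :=
  Out.eval_mat (S.eval_order w env) (S.eval_order w)
    fun env => holds_cobAdj (S.eval_rows w env) (S.holds_inc w env)

theorem reducible_grundyDomination (S : Source P) : PolyTimeFPTReducible P GrundyDomination :=
  S.reducible zeroNotMem_grundyDomination S.cob 2 fun w k _ => by
    rw [eval_cob, cob_mem_grundyDomination_iff (S.inc_lt w)]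

theorem reducible_totalGrundyDomination (S : Source P) : PolyTimeFPTReducible P TotalGrundyDomination :=
  S.reducible zeroNotMem_totalGrundyDomination S.cob 4 fun w k _ => by
    rw [eval_cob, cob_mem_totalGrundyDomination_iff (S.inc_lt w)]

theorem reducible_lGrundyDomination (S : Source P) : PolyTimeFPTReducible P LGrundyDomination :=
  S.reducible zeroNotMem_lGrundyDomination S.cob 4 fun w k _ => by
    rw [eval_cob, cob_mem_lGrundyDomination_iff (S.inc_lt w)]

theorem reducible_oneSided (S : Source P) : PolyTimeFPTReducible P OneSidedGrundyTotalDomination :=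
  S.reducible zeroNotMem_oneSided
    (.mat (add (add S.order S.order) (const 1)) (add S.order S.order)
      (add (mul (eq (var 2) (const 0)) (lt (var 3) S.order)) (mul (not (eq (var 2) (const 0)))
        (Expr.coverAdj S.order (Expr.cobAdj S.rows S.inc) (sub (var 2) (const 1)) (var 3))))) 4
    fun w k _ => by
      rw [← cover_mem_oneSided_iff (S.inc_lt w) rfl, Out.eval_mat]
      · simp [S.eval_order]
      · simp [S.eval_order]
      · intro env
        simp only [holds_add, holds_mul, holds_eq, holds_lt, holds_not, S.eval_order, eval_var,
          eval_const, holds_coverAdj (S.eval_order w env)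
            fun a b => holds_cobAdj (S.eval_rows w env) (S.holds_inc w env), eval_sub, ne_eq]

theorem reducible_grundyCovering (S : Source P) : PolyTimeFPTReducible P GrundyCovering :=
  S.reducible zeroNotMem_grundyCovering
    (.mat (add S.rows (const 1)) S.cols
      (add (eq (var 2) (const 0)) (S.inc (sub (var 2) (const 1)) (var 3)))) 0
    fun w k _ => by
      rw [← mat_mem_grundyCovering_iff (S.inc_lt w), Out.eval_mat, Nat.add_zero]
      · simp [S.eval_rows]
      · exact S.eval_cols w
      · intro env
        simp [S.holds_inc]

end Source

end GrundyFPT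
end

theorem mainTheorem7 :
    ∀ P ∈ ({GrundyFPT.GrundyDomination, GrundyFPT.TotalGrundyDomination,
        GrundyFPT.OneSidedGrundyTotalDomination, GrundyFPT.LGrundyDomination,
        GrundyFPT.GrundyCovering} : Set (GrundyFPT.ParamProblem GrundyFPT.Letter)),
      ∀ Q ∈ ({GrundyFPT.GrundyDomination, GrundyFPT.TotalGrundyDomination,
          GrundyFPT.OneSidedGrundyTotalDomination, GrundyFPT.LGrundyDomination,
          GrundyFPT.GrundyCovering} : Set (GrundyFPT.ParamProblem GrundyFPT.Letter)),
        GrundyFPT.FPTEquivalent P Q ∧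
          GrundyFPT.PolyTimeFPTReducible P Q ∧ GrundyFPT.PolyTimeFPTReducible Q P := by
  -- Each problem yields an incidence relation, and every such relation can be expressed in each
  -- problem, so five facts of each kind give all reductions.
  have hS : ∀ P ∈ ({GrundyFPT.GrundyDomination, GrundyFPT.TotalGrundyDomination,
      GrundyFPT.OneSidedGrundyTotalDomination, GrundyFPT.LGrundyDomination,
      GrundyFPT.GrundyCovering} : Set (GrundyFPT.ParamProblem GrundyFPT.Letter)),
      Nonempty (GrundyFPT.Source P) := by
    rintro P (rfl | rfl | rfl | rfl | rfl)
    · exact GrundyFPT.nonempty_source_grundyDomination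
    · exact GrundyFPT.nonempty_source_totalGrundyDomination
    · exact GrundyFPT.nonempty_source_oneSided
    · exact GrundyFPT.nonempty_source_lGrundyDomination
    · exact GrundyFPT.nonempty_source_grundyCovering
  have hR : ∀ P ∈ ({GrundyFPT.GrundyDomination, GrundyFPT.TotalGrundyDomination,
      GrundyFPT.OneSidedGrundyTotalDomination, GrundyFPT.LGrundyDomination,
      GrundyFPT.GrundyCovering} : Set (GrundyFPT.ParamProblem GrundyFPT.Letter)),
      ∀ Q ∈ ({GrundyFPT.GrundyDomination, GrundyFPT.TotalGrundyDomination,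
        GrundyFPT.OneSidedGrundyTotalDomination, GrundyFPT.LGrundyDomination,
        GrundyFPT.GrundyCovering} : Set (GrundyFPT.ParamProblem GrundyFPT.Letter)),
      GrundyFPT.PolyTimeFPTReducible P Q := by
    intro P hP
    obtain ⟨S⟩ := hS P hP
    rintro Q (rfl | rfl | rfl | rfl | rfl)
    · exact S.reducible_grundyDomination
    · exact S.reducible_totalGrundyDomination
    · exact S.reducible_oneSided
    · exact S.reducible_lGrundyDomination
    · exact S.reducible_grundyCovering
  exact fun P hP Q hQ => ⟨⟨(hR P hP Q hQ).fptReducible, (hR Q hQ P hP).fptReducible⟩,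
    hR P hP Q hQ, hR Q hQ P hP⟩
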